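/- **Setting.** For a subshift $X\subseteq A^{\mathbb Z}$ over a finite alphabet ($X$ closed and $T(X)=X$ for the shift $T$), let $L(X)$ be the set of finite words occurring in elements of $X$, $L_n(X)$ the set of those of length $n$ and $p_X(n)=\#L_n(X)$. $X$ is minimal if its only closed shift-invariant subsets are $\emptyset$ and $X$. Let $\mathcal C$ be the class of minimal subshifts with $1\le p_X(n+1)-p_X(n)\le 2$ for all $n\ge 0$. A word $u\in L(X)$ is right (left) special if $ua,ub\in L(X)$ ($au,bu\in L(X)$) for two distinct letters $a,b$, and bispecial if it is both. **Rauzy graphs.** The Rauzy graph $G_n(X)$ has vertex set $L_n(X)$; each word $e\in L_{n+1}(X)$ is an edge from its prefix to its suffix of length $n$, with right label its last letter. The right label $\lambda_R(p)$ of a path $p$ is the word of the right labels of its edges. An allowed $n$-circuit from a right special $u\in L_n(X)$ is a non-empty path $p$ from $u$ to $u$, with no interior vertex equal to $u$, such that $u\lambda_R(p)\in L(X)$. The reduced Rauzy graph $g_n(X)$ has as vertices the vertices of $G_n(X)$ that are left or right special (or that have no right extension or no left extension in $L(X)$), and as edges the non-empty paths of $G_n(X)$ between two such vertices all of whose interior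 vertices are not special. The map $\psi_n$ sends a path of $G_{n+1}(X)$ to the path of $G_n(X)$ with the same right label whose end vertices are the suffixes of length $n$ of the original ones. **Types.** $G_n(X)$ is of type $1,\dots,10$ if the directed multigraph $g_n(X)$ is isomorphic to the corresponding graph (exponents are multiplicities of parallel edges; $B,B_1,B_2$ are bispecial, $R$ is only right special, $L$ is only left special): 1: $(B\to B)^2$; 2: $(B\to B)^3$; 3: $B\to B,\ (B\to L)^2,\ L\to B$; 4: $(R\to B)^2,\ B\to B,\ B\to R$; 5: $(R\to B)^2,\ (B\to L)^2,\ L\to R$; 6: $(B_1\to B_2)^2,\ (B_2\to B_1)^2$; 7: $R\to B,\ B\to B,\ B\to L,\ L\to R,\ R\to L$; 8: $B_1\to B_2,\ B_2\to B_1,\ B_1\to B_1,\ B_2\to B_2$; 9: $(R\to L)^2,\ L\to B,\ B\to R,\ B\to B$; 10: $R\to B,\ R\to L,\ L\to B,\ B\to R,\ B\to L$. **Coding of evolutions.** Let $X\in\mathcal C$ have alphabet $A=\{0,\dots,\#A-1\}$, all of whose letters occur in $X$. Let $i_0<i_1<\cdots$ be the lengths of the bispecial words of $X$, and let $(U_n)_{n\ge0}$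 be right special words with $|U_n|=n$ and $U_n$ a suffix of $U_{n+1}$. For each $n$ let $A_n=\{0,\dots,c_n-1\}$, where $c_n$ is the number of allowed $i_n$-circuits from $U_{i_n}$, and let $\theta_n$ be a bijection from $A_n$ to the set of these circuits, with $\lambda_R(\theta_0(a))=a$ for all $a$, subject to the following rules, according to the type of $G_{i_n}(X)$. A segment is a path between two right special vertices without any other right special vertex. The circuit $\theta_n(2)$ need not exist where it is said to be optional. - Type 1: no condition. Types 2 and 3: $A_n=\{0,1,2\}$ and $\lambda_R(\theta_n(a))$ begins with the letter $a$. - Types 4 and 9, $U_{i_n}=R$: $\theta_n(0)$ and $\theta_n(1)$ begin with the two different segments from $R$ to $B$ and then go $k$, respectively $\ell$, times through the loop $B\to B$, where $k\ge\ell\ge0$, $k+\ell\ge1$, and moreover $k-\ell\le1$ for type 9; the optional $\theta_n(2)$ begins like $\theta_n(0)$ and goes $k-1$ times through the loop. For $U_{i_n}=B$: there are three circuits, and $\theta_n(0)$ is the loop $B\to B$. - Types 5 and 6: with $V$ the right special vertex other than $U_{i_n}$, $\theta_n(0)$ and $\theta_n(1)$ use different segments from $U_{i_n}$ to $V$ and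 different segments from $V$ to $U_{i_n}$; the optional $\theta_n(2)$ leaves like $\theta_n(0)$ and comes back like $\theta_n(1)$. - Types 7 and 8: with $V$ the right special vertex other than $U_{i_n}$, $\theta_n(0)$ does not pass through $V$; $\theta_n(1)$ goes to $V$, goes $k\ge1$ times through the circuit at $V$ that avoids $U_{i_n}$, and comes back; the optional $\theta_n(2)$ does the same with $k-1$ in place of $k$. - Type 10: let $x$ be the segment $R\to B$ and $y$ the segment $R\to L\to B$. For $U_{i_n}=R$: $\theta_n(0)$ begins with $y$ and goes $k$ times through $B\to L\to B$, and $\theta_n(1)$ begins with $x$ and goes $\ell$ times through it, $k+\ell\ge1$; the optional $\theta_n(2)$ either begins with $y$ and goes $k-1$ times through it (then $k\ge1$ and $\ell\le k$), or begins with $x$ and goes $\ell-1$ times through it (then $k\le\ell-1$). For $U_{i_n}=B$: $\theta_n(0)$ is $B\to L\to B$, and $\theta_n(1)$, $\theta_n(2)$ are the circuits through $y$ and $x$ respectively. Extend $\theta_n$ to words by concatenation. The morphism $\gamma_{i_n}:A_{n+1}^*\to A_n^*$ is the unique one with $\theta_n\gamma_{i_n}=\psi_{i_n}\psi_{i_n+1}\cdots\psi_{i_{n+1}-1}\theta_{n+1}$.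 The pair (sequence of the types of $G_{i_0}(X),G_{i_1}(X),\dots$; sequence of labels $\gamma_{i_0},\gamma_{i_1},\dots$) is said to be realized by $X$. **The graph of graphs** $\mathcal G$ has the ten types as vertices; there is an edge from $t$ to $t'$ labelled by $\gamma$ if, for some $X\in\mathcal C$, some choices as above and some $n$, $G_{i_n}(X)$ is of type $t$, $G_{i_{n+1}}(X)$ is of type $t'$ and $\gamma_{i_n}=\gamma$. An infinite labelled path in $\mathcal G$ is valid if it is realized by some $X\in\mathcal C$ (for some choices as above); a finite labelled path is a valid prefix if it is a prefix of a valid path. **Morphisms.** A sequence of morphisms $(\sigma_n:A_{n+1}^*\to A_n^*)_{n\ge0}$ is weakly primitive if for every $r$ there is $s>r$ such that every letter $a\in A_r$ occurs in $\sigma_r\cdots\sigma_s(b)$ for every letter $b\in A_{s+1}$. A contraction of it is a sequence $\tau_n=\sigma_{j_n}\sigma_{j_n+1}\cdots\sigma_{j_{n+1}-1}$ with $j_0<j_1<\cdots$. A morphism $\tau:A^*\to B^*$ is right proper if there is a letter $b\in B$ such that $\tau(a)\in B^*b$ for all $a\in A$. **Proposition.** An infinite labelled path $p$ in $\mathcal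 G$ is valid if and only if both of the following conditions hold: 1. all (finite) prefixes of $p$ are valid prefixes; 2. its label is weakly primitive and has a contraction that consists only of right proper morphisms. -/

import Mathlib

open SymbolicDynamics.FullShift

namespace RauzyPath

/-! ### Languages of subshifts, complexity, special factors -/

section Language

variable {A : Type}

/-- The set of finite words occurring in some element of the subshift `X`. -/
def language [TopologicalSpace A] (X : Subshift A ℤ) : Set (List A) :=
  {w | ∃ x ∈ X.carrier, ∃ i : ℤ, ∀ (j : ℕ) (hj : j < w.length), w[j] = x (i + (j : ℤ))}

/-- Number of words of length `n` in the language `L`. -/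
noncomputable def complexity (L : Set (List A)) (n : ℕ) : ℕ :=
  {w : List A | w ∈ L ∧ w.length = n}.ncard

/-- The only closed shift-invariant subsets of `X` are `X` and the empty set. -/
def IsMinimalSubshift [TopologicalSpace A] (X : Subshift A ℤ) : Prop :=
  ∀ Y : Subshift A ℤ, Y.carrier ⊆ X.carrier → Y.carrier = ∅ ∨ Y.carrier = X.carrier

/-- The class of subshifts under study: minimal, with `1 ≤ p(n+1) - p(n) ≤ 2` for all `n`. -/
def InClass [TopologicalSpace A] (X : Subshift A ℤ) : Prop :=
  IsMinimalSubshift X ∧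
    ∀ n, complexity (language X) n + 1 ≤ complexity (language X) (n + 1) ∧
      complexity (language X) (n + 1) ≤ complexity (language X) n + 2

/-- `u` is a word of `L` with two different right extensions in `L`. -/
def IsRightSpecial (L : Set (List A)) (u : List A) : Prop :=
  u ∈ L ∧ ∃ a b : A, a ≠ b ∧ u ++ [a] ∈ L ∧ u ++ [b] ∈ L

/-- `u` is a word of `L` with two different left extensions in `L`. -/
def IsLeftSpecial (L : Set (List A)) (u : List A) : Prop :=
  u ∈ L ∧ ∃ a b : A, a ≠ b ∧ a :: u ∈ L ∧ b :: u ∈ L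

def IsBispecial (L : Set (List A)) (u : List A) : Prop :=
  IsRightSpecial L u ∧ IsLeftSpecial L u

def IsSpecial (L : Set (List A)) (u : List A) : Prop :=
  IsRightSpecial L u ∨ IsLeftSpecial L u

/-- `u` has no right extension, or no left extension, in `L`. -/
def IsBoundary (L : Set (List A)) (u : List A) : Prop :=
  (∀ a : A, u ++ [a] ∉ L) ∨ (∀ a : A, a :: u ∉ L)

/-! ### Rauzy graphs

The Rauzy graph of order `n` has the words of length `n` of `L` as vertices, and every word `e` of
length `n + 1` of `L` is an edge from its prefix `e.dropLast` to its suffix `e.tail`. The right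
label of `e` is its last letter. A path is a list of consecutive edges. -/

/-- `IsPath L n u p v`: `p` is a path from `u` to `v` in the Rauzy graph of order `n`. -/
inductive IsPath (L : Set (List A)) (n : ℕ) : List A → List (List A) → List A → Prop
  | nil (u : List A) (hu : u ∈ L) (hn : u.length = n) : IsPath L n u [] u
  | cons (e : List A) (p : List (List A)) (v : List A) (he : e ∈ L) (hn : e.length = n + 1)
      (hp : IsPath L n e.tail p v) : IsPath L n e.dropLast (e :: p) v

/-- The right label of a path: the word of the last letters of its edges. -/
def rightLabel (p : List (List A)) : List A := p.filterMap List.getLast?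

/-- `p` is an allowed `n`-circuit starting from the right special vertex `u`: a non-empty path from
`u` to `u`, none of whose interior vertices is `u`, and whose full label
(`u` followed by the right label) is in `L`. -/
def IsAllowedCircuit (L : Set (List A)) (n : ℕ) (u : List A) (p : List (List A)) : Prop :=
  IsRightSpecial L u ∧ IsPath L n u p u ∧ p ≠ [] ∧ (∀ e ∈ p.tail, e.dropLast ≠ u) ∧
    u ++ rightLabel p ∈ L

/-- The map from paths of the Rauzy graph of order `n + 1` to paths of the Rauzy graph of order `n`
which keeps the right label and takes the suffix of length `n` of every vertex. -/
def psi (p : List (List A)) : List (List A) := p.map List.tail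

/-! ### Directed multigraphs and reduced Rauzy graphs -/

/-- Directed graphs with parallel edges and loops. -/
structure MultiDigraph where
  V : Type
  E : Type
  src : E → V
  tgt : E → V

/-- Isomorphisms of directed multigraphs. -/
structure MultiDigraph.Iso (G H : MultiDigraph) where
  onV : G.V ≃ H.V
  onE : G.E ≃ H.E
  src_eq : ∀ e, H.src (onE e) = onV (G.src e)
  tgt_eq : ∀ e, H.tgt (onE e) = onV (G.tgt e)

/-- Vertices of the reduced Rauzy graph: special vertices (and boundary vertices). -/
def IsReducedVertex (L : Set (List A)) (n : ℕ) (u : List A) : Prop :=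
  u ∈ L ∧ u.length = n ∧ (IsSpecial L u ∨ IsBoundary L u)

/-- Edges of the reduced Rauzy graph: non-empty paths of the Rauzy graph between two vertices of
the reduced Rauzy graph, all of whose interior vertices are not special. -/
structure ReducedEdge (L : Set (List A)) (n : ℕ) where
  path : List (List A)
  src : {u : List A // IsReducedVertex L n u}
  tgt : {u : List A // IsReducedVertex L n u}
  isPath : IsPath L n src.1 path tgt.1
  ne_nil : path ≠ []
  interior : ∀ e ∈ path.tail, ¬ IsSpecial L e.dropLast

/-- The reduced Rauzy graph of order `n`. -/
def reducedRauzyGraph (L : Set (List A)) (n : ℕ) : MultiDigraph where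
  V := {u : List A // IsReducedVertex L n u}
  E := ReducedEdge L n
  src := ReducedEdge.src
  tgt := ReducedEdge.tgt

end Language

/-! ### The ten types of reduced Rauzy graphs -/

/-- The ten types of reduced Rauzy graphs with a bispecial vertex. -/
inductive RauzyType
  | t1 | t2 | t3 | t4 | t5 | t6 | t7 | t8 | t9 | t10

/-- The shape of the graphs of each type. `B`, `B₁`, `B₂` stand for bispecial vertices, `R` for a
vertex that is right special only and `L` for a vertex that is left special only. -/
def shape : RauzyType → MultiDigraph
  -- `B = 0`; two loops
  | .t1 => ⟨Fin 1, Fin 2, ![0, 0], ![0, 0]⟩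
  -- `B = 0`; three loops
  | .t2 => ⟨Fin 1, Fin 3, ![0, 0, 0], ![0, 0, 0]⟩
  -- `B = 0`, `L = 1`; `0 : B → B`, `1, 2 : B → L`, `3 : L → B`
  | .t3 => ⟨Fin 2, Fin 4, ![0, 0, 0, 1], ![0, 1, 1, 0]⟩
  -- `R = 0`, `B = 1`; `0, 1 : R → B`, `2 : B → B`, `3 : B → R`
  | .t4 => ⟨Fin 2, Fin 4, ![0, 0, 1, 1], ![1, 1, 1, 0]⟩
  -- `R = 0`, `B = 1`, `L = 2`; `0, 1 : R → B`, `2, 3 : B → L`, `4 : L → R`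
  | .t5 => ⟨Fin 3, Fin 5, ![0, 0, 1, 1, 2], ![1, 1, 2, 2, 0]⟩
  -- `B₁ = 0`, `B₂ = 1`; `0, 1 : B₁ → B₂`, `2, 3 : B₂ → B₁`
  | .t6 => ⟨Fin 2, Fin 4, ![0, 0, 1, 1], ![1, 1, 0, 0]⟩
  -- `R = 0`, `B = 1`, `L = 2`; `0 : R → B`, `1 : B → B`, `2 : B → L`, `3 : L → R`, `4 : R → L`
  | .t7 => ⟨Fin 3, Fin 5, ![0, 1, 1, 2, 0], ![1, 1, 2, 0, 2]⟩
  -- `B₁ = 0`, `B₂ = 1`; `0 : B₁ → B₂`, `1 : B₂ → B₁`, `2 : B₁ → B₁`, `3 : B₂ → B₂`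
  | .t8 => ⟨Fin 2, Fin 4, ![0, 1, 0, 1], ![1, 0, 0, 1]⟩
  -- `R = 0`, `B = 1`, `L = 2`; `0, 1 : R → L`, `2 : L → B`, `3 : B → R`, `4 : B → B`
  | .t9 => ⟨Fin 3, Fin 5, ![0, 0, 2, 1, 1], ![2, 2, 1, 0, 1]⟩
  -- `R = 0`, `B = 1`, `L = 2`; `0 : R → B`, `1 : R → L`, `2 : L → B`, `3 : B → R`, `4 : B → L`
  | .t10 => ⟨Fin 3, Fin 5, ![0, 0, 2, 1, 1], ![1, 2, 1, 0, 2]⟩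

/-- The concatenation of `k` copies of the word `u`. -/
def wpow {α : Type} (u : List α) (k : ℕ) : List α := (List.replicate k u).flatten

/-- `IsNaming t v cs`: in a graph of type `t`, the list `cs` (of length 2 or 3) is an admissible
choice of the circuits `θ(0), θ(1)` and possibly `θ(2)` starting from the right special vertex `v`,
every circuit being written as a word over the edges of the shape. (For the types 2 and 3 there is
the further condition `LetterCondition` on the first letters.) In the types 6 and 8
the vertex `v` can be taken to be `B₁`, because the shape has an automorphism that exchanges
`B₁` and `B₂`. -/
inductive IsNaming : (t : RauzyType) → (shape t).V → List (List (shape t).E) → Prop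
  /-- The two loops. -/
  | type1 : IsNaming .t1 (0 : Fin 1) ([[0], [1]] : List (List (Fin 2)))
  /-- The three loops. -/
  | type2 : IsNaming .t2 (0 : Fin 1) ([[0], [1], [2]] : List (List (Fin 3)))
  /-- The three circuits from `B`, in any order. -/
  | type3 (cs : List (List (Fin 4))) (h : cs.Perm [[0], [1, 3], [2, 3]]) :
      IsNaming .t3 (0 : Fin 2) cs
  /-- From `R`: `θ(0)` and `θ(1)` begin with different segments from `R` to `B` and go `k`,
  respectively `l`, times through the loop at `B`; the circuit `θ(2)`, if any, begins like `θ(0)`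
  and goes `k - 1` times through the loop. -/
  | type4R (k l : ℕ) (hkl : l ≤ k) (hpos : 1 ≤ k + l) (cs : List (List (Fin 4)))
      (h : cs = [[0] ++ wpow [2] k ++ [3], [1] ++ wpow [2] l ++ [3]] ∨
        cs = [[0] ++ wpow [2] k ++ [3], [1] ++ wpow [2] l ++ [3],
          [0] ++ wpow [2] (k - 1) ++ [3]]) :
      IsNaming .t4 (0 : Fin 2) cs
  /-- From `B`: `θ(0)` is the loop at `B`. -/
  | type4B : IsNaming .t4 (1 : Fin 2) ([[2], [3, 0], [3, 1]] : List (List (Fin 4)))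
  /-- `θ(0)` and `θ(1)` use different segments from the starting vertex to the other right special
  vertex, and different segments back; `θ(2)`, if any, leaves like `θ(0)` and comes back
  like `θ(1)`. -/
  | type5R (cs : List (List (Fin 5)))
      (h : cs = [[0, 2, 4], [1, 3, 4]] ∨ cs = [[0, 2, 4], [1, 3, 4], [0, 3, 4]]) :
      IsNaming .t5 (0 : Fin 3) cs
  /-- The same as `type5R` with `B` as the starting vertex. -/
  | type5B (cs : List (List (Fin 5)))
      (h : cs = [[2, 4, 0], [3, 4, 1]] ∨ cs = [[2, 4, 0], [3, 4, 1], [2, 4, 1]]) :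
      IsNaming .t5 (1 : Fin 3) cs
  /-- The same as `type5R` with `B₁` as the starting vertex. -/
  | type6 (cs : List (List (Fin 4)))
      (h : cs = [[0, 2], [1, 3]] ∨ cs = [[0, 2], [1, 3], [0, 3]]) :
      IsNaming .t6 (0 : Fin 2) cs
  /-- `θ(0)` does not pass through the other right special vertex; `θ(1)` goes there, goes `k` times
  through the loop and comes back; `θ(2)`, if any, does the same with `k - 1` instead of `k`. -/
  | type7R (k : ℕ) (hk : 1 ≤ k) (cs : List (List (Fin 5)))
      (h : cs = [[4, 3], [0] ++ wpow [1] k ++ [2, 3]] ∨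
        cs = [[4, 3], [0] ++ wpow [1] k ++ [2, 3], [0] ++ wpow [1] (k - 1) ++ [2, 3]]) :
      IsNaming .t7 (0 : Fin 3) cs
  /-- The same as `type7R` with `B` as the starting vertex. -/
  | type7B (k : ℕ) (hk : 1 ≤ k) (cs : List (List (Fin 5)))
      (h : cs = [[1], [2, 3] ++ wpow [4, 3] k ++ [0]] ∨
        cs = [[1], [2, 3] ++ wpow [4, 3] k ++ [0], [2, 3] ++ wpow [4, 3] (k - 1) ++ [0]]) :
      IsNaming .t7 (1 : Fin 3) cs
  /-- The same as `type7R` with `B₁` as the starting vertex. -/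
  | type8 (k : ℕ) (hk : 1 ≤ k) (cs : List (List (Fin 4)))
      (h : cs = [[2], [0] ++ wpow [3] k ++ [1]] ∨
        cs = [[2], [0] ++ wpow [3] k ++ [1], [0] ++ wpow [3] (k - 1) ++ [1]]) :
      IsNaming .t8 (0 : Fin 2) cs
  /-- From `R`: like `type4R`, with `l = k` or `l = k - 1`. -/
  | type9R (k l : ℕ) (hkl : l ≤ k) (hkl' : k ≤ l + 1) (hpos : 1 ≤ k + l)
      (cs : List (List (Fin 5)))
      (h : cs = [[0, 2] ++ wpow [4] k ++ [3], [1, 2] ++ wpow [4] l ++ [3]] ∨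
        cs = [[0, 2] ++ wpow [4] k ++ [3], [1, 2] ++ wpow [4] l ++ [3],
          [0, 2] ++ wpow [4] (k - 1) ++ [3]]) :
      IsNaming .t9 (0 : Fin 3) cs
  /-- From `B`: `θ(0)` is the loop at `B`. -/
  | type9B : IsNaming .t9 (1 : Fin 3) ([[4], [3, 0, 2], [3, 1, 2]] : List (List (Fin 5)))
  /-- From `R`, two circuits: `θ(0)` begins with the segment `y = R → L → B` and goes `k` times
  through the loop `B → L → B`; `θ(1)` begins with the segment `x = R → B` and goes `l` times
  through the loop. -/
  | type10R (k l : ℕ) (hpos : 1 ≤ k + l) :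
      IsNaming .t10 (0 : Fin 3) ([[1, 2] ++ wpow [4, 2] k ++ [3],
        [0] ++ wpow [4, 2] l ++ [3]] : List (List (Fin 5)))
  /-- From `R`, a third circuit that begins with `y` and goes `k - 1` times through the loop. -/
  | type10Ry (k l : ℕ) (hk : 1 ≤ k) (hkl : l ≤ k) :
      IsNaming .t10 (0 : Fin 3) ([[1, 2] ++ wpow [4, 2] k ++ [3],
        [0] ++ wpow [4, 2] l ++ [3], [1, 2] ++ wpow [4, 2] (k - 1) ++ [3]] : List (List (Fin 5)))
  /-- From `R`, a third circuit that begins with `x` and goes `l - 1` times through the loop. -/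
  | type10Rx (k l : ℕ) (hkl : k + 1 ≤ l) :
      IsNaming .t10 (0 : Fin 3) ([[1, 2] ++ wpow [4, 2] k ++ [3],
        [0] ++ wpow [4, 2] l ++ [3], [0] ++ wpow [4, 2] (l - 1) ++ [3]] : List (List (Fin 5)))
  /-- From `B`: the loop `B → L → B`, then the circuit through `y`, then the circuit through `x`. -/
  | type10B : IsNaming .t10 (1 : Fin 3) ([[4, 2], [3, 1, 2], [3, 0]] : List (List (Fin 5)))

/-- In the types 2 and 3, the right label of `θ(a)` begins with the letter `a`. -/
def LetterCondition {d c : ℕ} (t : RauzyType) (θ : Fin c → List (List (Fin d))) : Prop :=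
  (t = .t2 ∨ t = .t3) → ∀ a : Fin c, (rightLabel (θ a)).head?.map Fin.val = some a.val

/-- The Rauzy graph of order `n` is of type `t`, and the enumeration `θ` of the circuits starting
from the right special vertex `U` follows the naming procedure. -/
def FollowsProcedure {d c : ℕ} (L : Set (List (Fin d))) (n : ℕ) (t : RauzyType)
    (U : List (Fin d)) (θ : Fin c → List (List (Fin d))) : Prop :=
  ∃ (Φ : MultiDigraph.Iso (shape t) (reducedRauzyGraph L n)) (v : (shape t).V)
    (cs : List (List (shape t).E)),
    (Φ.onV v).1 = U ∧ IsNaming t v cs ∧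
      List.ofFn θ = cs.map (fun c => c.flatMap fun e => (Φ.onE e).path) ∧
      LetterCondition t θ

/-! ### Sequences of morphisms -/

/-- A sequence of morphisms `σ_n : A_{n+1}^* → A_n^*`, where `A_n = {0, …, card n - 1}`. -/
structure MorphismSeq where
  card : ℕ → ℕ
  mor : ∀ n, FreeMonoid (Fin (card (n + 1))) →* FreeMonoid (Fin (card n))

/-- The composition `σ_r σ_{r+1} ⋯ σ_{s-1} : A_s^* → A_r^*` (the identity for `s = r`). -/
def MorphismSeq.comp (σ : MorphismSeq) {r s : ℕ} (h : r ≤ s) :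
    FreeMonoid (Fin (σ.card s)) →* FreeMonoid (Fin (σ.card r)) :=
  Nat.leRec (motive := fun s _ => FreeMonoid (Fin (σ.card s)) →* FreeMonoid (Fin (σ.card r)))
    (MonoidHom.id _) (fun k _ f => f.comp (σ.mor k)) h

/-- For all `r` there is `s > r` such that every letter of `A_r` occurs in
`σ_r ⋯ σ_s(b)` for every letter `b` of `A_{s+1}`. -/
def MorphismSeq.WeaklyPrimitive (σ : MorphismSeq) : Prop :=
  ∀ r : ℕ, ∃ (s : ℕ) (h : r < s), ∀ (a : Fin (σ.card r)) (b : Fin (σ.card (s + 1))),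
    a ∈ FreeMonoid.toList (σ.comp (h.le.trans s.le_succ) (FreeMonoid.of b))

/-- The contraction of `σ` along a strictly increasing sequence of indices:
`τ_n = σ_{i_n} σ_{i_n + 1} ⋯ σ_{i_{n+1} - 1}`. -/
def MorphismSeq.contraction (σ : MorphismSeq) (i : ℕ → ℕ) (hi : StrictMono i) : MorphismSeq where
  card n := σ.card (i n)
  mor n := σ.comp (hi.monotone n.le_succ)

/-- All images of letters end with the same letter. -/
def IsRightProper {c d : ℕ} (τ : FreeMonoid (Fin c) →* FreeMonoid (Fin d)) : Prop :=
  ∃ a : Fin d, ∀ b : Fin c, ∃ u : FreeMonoid (Fin d), τ (FreeMonoid.of b) = u * FreeMonoid.of a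

/-! ### Labelled paths, realizations and the graph of graphs -/

/-- An infinite sequence of types in which every step is labelled by a morphism. -/
structure LabelledPath where
  type : ℕ → RauzyType
  label : MorphismSeq

/-- A step from the type `src` to the type `tgt`, labelled by a morphism. -/
structure LabelledEdge where
  src : RauzyType
  tgt : RauzyType
  domCard : ℕ
  codCard : ℕ
  mor : FreeMonoid (Fin domCard) →* FreeMonoid (Fin codCard)

def LabelledPath.edge (p : LabelledPath) (n : ℕ) : LabelledEdge :=
  ⟨p.type n, p.type (n + 1), p.label.card (n + 1), p.label.card n, p.label.mor n⟩

/-- A way of reading the labelled path `p` in the evolution of the Rauzy graphs of `X`. -/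
structure Realization (p : LabelledPath) (X : Subshift (Fin (p.label.card 0)) ℤ) where
  /-- The increasing enumeration of the lengths of the bispecial factors. -/
  i : ℕ → ℕ
  i_strictMono : StrictMono i
  i_range : ∀ k, k ∈ Set.range i ↔ ∃ u, u.length = k ∧ IsBispecial (language X) u
  /-- A sequence of right special factors, each one being a suffix of the next one. -/
  U : ℕ → List (Fin (p.label.card 0))
  U_length : ∀ n, (U n).length = n
  U_rightSpecial : ∀ n, IsRightSpecial (language X) (U n)
  U_suffix : ∀ n, U n <:+ U (n + 1)
  /-- `θ n` is a bijection from the alphabet `A_{i_n}` to the set of allowed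
  `i_n`-circuits starting from `U_{i_n}`. -/
  θ : ∀ n, Fin (p.label.card n) → List (List (Fin (p.label.card 0)))
  θ_injective : ∀ n, Function.Injective (θ n)
  θ_range : ∀ n q, q ∈ Set.range (θ n) ↔ IsAllowedCircuit (language X) (i n) (U (i n)) q
  /-- The Rauzy graph of order `i_n` has the type `p.type n`, and `θ n` is as prescribed. -/
  θ_procedure : ∀ n, FollowsProcedure (language X) (i n) (p.type n) (U (i n)) (θ n)
  /-- The circuits of the Rauzy graph of order `0` are named by their labels. -/
  θ_zero : ∀ a, rightLabel (θ 0 a) = [a]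
  /-- The label of the path is the sequence of the morphisms
  `γ_{i_n}`, defined by `θ_{i_n} γ_{i_n} = ψ_{i_n} ⋯ ψ_{i_{n+1} - 1} θ_{i_{n+1}}`. -/
  label_eq : ∀ n a, (FreeMonoid.toList (p.label.mor n (FreeMonoid.of a))).flatMap (θ n) =
    psi^[i (n + 1) - i n] (θ (n + 1) a)

/-- The path is the labelled path of some minimal subshift such that
`1 ≤ p(n+1) - p(n) ≤ 2` for all `n`. -/
def LabelledPath.IsValid (p : LabelledPath) : Prop :=
  ∃ X : Subshift (Fin (p.label.card 0)) ℤ, InClass X ∧ Nonempty (Realization p X)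

/-- Edges of the graph of graphs: there is an edge from `t` to `u` labelled by `γ` if,
in some subshift of the class, a Rauzy graph of type `t` evolves to a Rauzy graph of type `u`
and this evolution is coded by `γ`. -/
def IsEdgeOfGraphOfGraphs (e : LabelledEdge) : Prop :=
  ∃ (q : LabelledPath) (X : Subshift (Fin (q.label.card 0)) ℤ) (n : ℕ),
    InClass X ∧ Nonempty (Realization q X) ∧ q.edge n = e

/-- The labelled path lies in the graph of graphs. -/
def LabelledPath.IsInGraphOfGraphs (p : LabelledPath) : Prop :=
  ∀ n, IsEdgeOfGraphOfGraphs (p.edge n)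

/-- The prefix of length `n` of `p` is the prefix of a valid path. -/
def LabelledPath.IsValidPrefix (p : LabelledPath) (n : ℕ) : Prop :=
  ∃ q : LabelledPath, q.IsValid ∧ ∀ k < n, q.edge k = p.edge k

end RauzyPath

/-!
The realization of a labelled path by a subshift `X` is read off from return words. The right labels
of the allowed circuits `θ_n(a)` are the return words to the right special word `U_{i_n}`, and,
since `ψ` preserves right labels, the return word `θ_n(a)` is the word `σ_0 ⋯ σ_{n-1}(a)`
(`MorphismSeq.word`), where `σ` is the label of the path. Occurrences of `U_{i_n}` in a
concatenation of return words are exactly the boundaries of the blocks (`IsReturnCoding.encode`,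
`IsReturnCoding.decode`), so the image `σ_r ⋯ σ_{s-1}(b)` describes the decomposition of the return
word `b` of level `s` into return words of level `r`.

Necessity. Return words to long words are long (`RecurrentLanguage.le_length_return`: a short return
is a short period), and minimality makes long words contain all short ones; hence weak
primitivity. If `U_{i_s}` is longer than all the complete returns `U_{i_r} σ_0 ⋯ σ_{r-1}(a)`, then
it ends with exactly one of them, and the letter of this one ends all the words `σ_r ⋯ σ_{s-1}(b)`;
hence a right proper contraction.

Sufficiency. Let `X_N` realize the prefix of length `N`. If `σ_s ⋯ σ_{t-1}` is right proper with last
letter `c`, then `z = σ_0 ⋯ σ_{s-1}(c)` is a common suffix of the words `σ_0 ⋯ σ_{t-1}(b)`, and for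
`N ≥ t` the words of `X_N` of length at most `|z|` are the factors of the words
`z σ_0 ⋯ σ_{t-1}(b)` (`PartialRealization.mem_language_iff`). They do not depend on `N`, and `|z|`
tends to infinity by weak primitivity, so the languages of the `X_N` converge. By compactness the
limit is the language of a subshift, which is minimal by weak primitivity, and which inherits the
bounds on the complexity. The words `U_n` of `X_N` are suffixes of `z`, so they stabilize. A right
special word is a suffix of a bispecial one (`RecurrentLanguage.exists_bispecial`), so the limit has
infinitely many bispecial lengths, and the `n`-th one is the limit of those of the `X_N`. All the
conditions of a realization at level `n` involve words of bounded length only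
(`FollowsProcedure.of_agreeUpTo`), so they pass to the limit.
-/

namespace RauzyPath

/-! ### Windows and languages -/

section Windows

variable {A : Type}

/-- The word of length `n` read in the configuration `x` from the position `i` on. -/
def window (x : ℤ → A) (i : ℤ) (n : ℕ) : List A := List.ofFn fun j : Fin n => x (i + (j : ℕ))

@[simp] lemma length_window (x : ℤ → A) (i : ℤ) (n : ℕ) : (window x i n).length = n := by
  simp [window]

lemma window_add (x : ℤ → A) (i : ℤ) (m n : ℕ) :
    window x i (m + n) = window x i m ++ window x (i + m) n := by
  simp only [window, List.ofFn_add]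
  congr 2
  · ext j; simp [add_assoc]

lemma window_shift (x : ℤ → A) (g i : ℤ) (n : ℕ) :
    window (shift g x) i n = window x (g + i) n := by
  simp [window, add_assoc]

lemma window_congr {x y : ℤ → A} {i : ℤ} {n : ℕ}
    (h : ∀ j : ℕ, j < n → x (i + j) = y (i + j)) : window x i n = window y i n := by
  simp only [window]
  congr 1
  ext j
  exact h j j.2

lemma apply_eq_of_window_eq {x y : ℤ → A} {i : ℤ} {n : ℕ} (h : window x i n = window y i n)
    {a : ℕ} (ha : a < n) : x (i + a) = y (i + a) :=
  congrFun (List.ofFn_injective h) ⟨a, ha⟩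

/-- The part of a window that corresponds to a factor of it. -/
lemma window_eq_of_append {x : ℤ → A} {i : ℤ} {n : ℕ} {a v b : List A}
    (h : window x i n = a ++ v ++ b) : window x (i + a.length) v.length = v := by
  have hn : n = a.length + v.length + b.length := by
    have := congrArg List.length h
    simpa [add_assoc] using this
  rw [hn, window_add, window_add] at h
  have h1 := (List.append_inj h (by simp)).1
  exact (List.append_inj h1 (by simp)).2

lemma mem_language [TopologicalSpace A] {X : Subshift A ℤ} {w : List A} :
    w ∈ language X ↔ ∃ x ∈ X.carrier, ∃ i : ℤ, window x i w.length = w := by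
  constructor
  · rintro ⟨x, hx, i, h⟩
    refine ⟨x, hx, i, ?_⟩
    apply List.ext_getElem (by simp)
    intro j h1 h2
    simp [window, h j h2]
  · rintro ⟨x, hx, i, h⟩
    refine ⟨x, hx, i, fun j hj => ?_⟩
    have : w[j] = (window x i w.length)[j]'(by simpa using hj) := by simp only [h]
    rw [this]
    simp [window]

lemma window_mem_language [TopologicalSpace A] {X : Subshift A ℤ} {x : ℤ → A}
    (hx : x ∈ X.carrier) (i : ℤ) (n : ℕ) : window x i n ∈ language X :=
  mem_language.2 ⟨x, hx, i, by simp⟩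

lemma language_factorial [TopologicalSpace A] {X : Subshift A ℤ} {v w : List A}
    (h : v <:+: w) (hw : w ∈ language X) : v ∈ language X := by
  obtain ⟨x, hx, i, hi⟩ := mem_language.1 hw
  obtain ⟨a, b, rfl⟩ := h
  exact mem_language.2 ⟨x, hx, _, window_eq_of_append hi⟩

lemma language_extend [TopologicalSpace A] {X : Subshift A ℤ} {w : List A}
    (hw : w ∈ language X) (K : ℕ) :
    ∃ a b : List A, a.length = K ∧ b.length = K ∧ a ++ w ++ b ∈ language X := by
  obtain ⟨x, hx, i, hi⟩ := mem_language.1 hw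
  refine ⟨window x (i - K) K, window x (i + w.length) K, by simp, by simp, ?_⟩
  have := window_mem_language hx (i - K) (K + w.length + K)
  rw [window_add, window_add] at this
  have e1 : i - (K : ℤ) + (K : ℤ) = i := by ring
  have e2 : i - (K : ℤ) + ((K + w.length : ℕ) : ℤ) = i + w.length := by push_cast; ring
  rwa [e1, e2, hi] at this

lemma isClopen_window_eq [TopologicalSpace A] [DiscreteTopology A] (i : ℤ) (w : List A) :
    IsClopen {x : ℤ → A | window x i w.length = w} := by
  have : {x : ℤ → A | window x i w.length = w} =
      ⋂ j : Fin w.length, {x : ℤ → A | x (i + (j : ℕ)) = w[j]} := by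
    ext x
    simp only [Set.mem_ofPred_eq, Set.mem_iInter]
    constructor
    · intro h j
      have : w[j] = (window x i w.length)[(j : ℕ)]'(by simp) := by simp only [h]; rfl
      rw [this]
      simp [window]
    · intro h
      apply List.ext_getElem (by simp)
      intro j h1 h2
      simpa [window] using h ⟨j, h2⟩
  rw [this]
  apply isClopen_iInter_of_finite
  intro j
  exact (isClopen_discrete {w[j]}).preimage (continuous_apply (i + ((j : ℕ) : ℤ)))

end Windows

/-! ### Recurrence in minimal subshifts -/

section Recurrence

variable {A : Type}

/-- The properties of the language of a subshift of the class on which the proof relies: it is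
closed under taking factors, every word extends to both sides, it is uniformly recurrent, and its
complexity is unbounded. -/
structure RecurrentLanguage (L : Set (List A)) : Prop where
  nil_mem : [] ∈ L
  factorial : ∀ {v w : List A}, v <:+: w → w ∈ L → v ∈ L
  extend : ∀ {w : List A}, w ∈ L → ∀ K : ℕ,
    ∃ a b : List A, a.length = K ∧ b.length = K ∧ a ++ w ++ b ∈ L
  recurrent : ∀ {u : List A}, u ∈ L → ∃ K : ℕ, ∀ v ∈ L, K ≤ v.length → u <:+: v
  le_complexity : ∀ n, n ≤ complexity L n

/-- Uniform recurrence: if a word of a minimal subshift were missing from arbitrarily long words,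
then, by compactness, it would be missing from some configuration, and the configurations from
which it is missing would form a proper subshift. -/
lemma IsMinimalSubshift.recurrent [TopologicalSpace A] [DiscreteTopology A] [Finite A]
    {X : Subshift A ℤ} (hX : IsMinimalSubshift X) {u : List A} (hu : u ∈ language X) :
    ∃ K : ℕ, ∀ v ∈ language X, K ≤ v.length → u <:+: v := by
  by_contra! hcon
  let F : ℕ → Set (ℤ → A) := fun K => X.carrier ∩
    ⋂ j : ℤ, ⋂ (_ : -(K : ℤ) ≤ j ∧ j ≤ K), {x | window x j u.length = u}ᶜ
  have hFcl : ∀ K, IsClosed (F K) := fun K =>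
    X.isClosed.inter (isClosed_iInter fun j => isClosed_iInter fun _ =>
      (isClopen_window_eq j u).compl.isClosed)
  have hFne : ∀ K, (F K).Nonempty := by
    intro K
    obtain ⟨v, hv, hvK, huv⟩ := hcon (2 * K + u.length)
    obtain ⟨x, hx, i, hi⟩ := mem_language.1 hv
    refine ⟨shift (i + K) x, X.mapsTo _ hx, ?_⟩
    simp only [Set.mem_iInter, Set.mem_compl_iff, Set.mem_ofPred_eq]
    rintro j ⟨hj1, hj2⟩ hw
    apply huv
    rw [window_shift] at hw
    obtain ⟨a, ha⟩ : ∃ a : ℕ, (a : ℤ) = K + j := ⟨(K + j).toNat, by omega⟩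
    have hle : a + u.length ≤ v.length := by omega
    obtain ⟨b, hb⟩ := Nat.exists_eq_add_of_le hle
    rw [hb, window_add, window_add] at hi
    have e : i + (a : ℤ) = i + K + j := by rw [ha]; ring
    rw [e, hw] at hi
    exact ⟨_, _, hi⟩
  have hmono : ∀ K, F (K + 1) ⊆ F K := by
    rintro K x ⟨hx, h⟩
    refine ⟨hx, ?_⟩
    simp only [Set.mem_iInter] at h ⊢
    intro j hj
    exact h j (by push_cast; omega)
  obtain ⟨x, hx⟩ := IsCompact.nonempty_iInter_of_sequence_nonempty_isCompact_isClosed F hmono hFne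
    (hFcl 0).isCompact hFcl
  rw [Set.mem_iInter] at hx
  let Y : Subshift A ℤ :=
    { carrier := X.carrier ∩ ⋂ j : ℤ, {x | window x j u.length = u}ᶜ
      isClosed := X.isClosed.inter (isClosed_iInter fun j =>
        (isClopen_window_eq j u).compl.isClosed)
      mapsTo := by
        rintro g y ⟨hy, h⟩
        refine ⟨X.mapsTo g hy, ?_⟩
        simp only [Set.mem_iInter, Set.mem_compl_iff, Set.mem_ofPred_eq] at h ⊢
        intro j
        rw [window_shift]
        exact h _ }
  have hxY : x ∈ Y.carrier := by
    refine ⟨(hx 0).1, ?_⟩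
    rw [Set.mem_iInter]
    intro j
    have := (hx j.natAbs).2
    simp only [Set.mem_iInter] at this
    exact this j (by omega)
  rcases hX Y Set.inter_subset_left with h | h
  · rw [h] at hxY
    exact hxY
  · obtain ⟨y, hy, i, hi⟩ := mem_language.1 hu
    rw [← h] at hy
    have := hy.2
    simp only [Set.mem_iInter] at this
    exact this i hi

lemma InClass.recurrentLanguage [TopologicalSpace A] [DiscreteTopology A] [Finite A]
    {X : Subshift A ℤ} (hX : InClass X) : RecurrentLanguage (language X) where
  nil_mem := by
    by_contra h
    have hL : ∀ w, w ∉ language X := fun w hw => h (language_factorial (List.nil_infix) hw)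
    have := (hX.2 0).1
    simp [complexity, hL] at this
  factorial := language_factorial
  extend := language_extend
  recurrent := hX.1.recurrent
  le_complexity := by
    intro n
    induction n with
    | zero => exact Nat.zero_le _
    | succ n ih => have := (hX.2 n).1; omega

namespace RecurrentLanguage

variable {L : Set (List A)}

lemma extend_right (hL : RecurrentLanguage L) {w : List A} (hw : w ∈ L) (K : ℕ) :
    ∃ b : List A, b.length = K ∧ w ++ b ∈ L := by
  obtain ⟨a, b, -, hb, h⟩ := hL.extend hw K
  exact ⟨b, hb, hL.factorial ⟨a, [], by simp⟩ h⟩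

lemma extend_left (hL : RecurrentLanguage L) {w : List A} (hw : w ∈ L) (K : ℕ) :
    ∃ a : List A, a.length = K ∧ a ++ w ∈ L := by
  obtain ⟨a, b, ha, -, h⟩ := hL.extend hw K
  exact ⟨a, ha, hL.factorial ⟨[], b, by simp⟩ h⟩

/-- Every word reappears to the left of any word. -/
lemma exists_left (hL : RecurrentLanguage L) {u w : List A} (hu : u ∈ L) (hw : w ∈ L) :
    ∃ x : List A, u ++ x ++ w ∈ L := by
  obtain ⟨K, hK⟩ := hL.recurrent hu
  obtain ⟨a, ha, h⟩ := hL.extend_left hw K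
  obtain ⟨s, t, rfl⟩ := hK a (hL.factorial ⟨[], w, by simp⟩ h) ha.ge
  exact ⟨t, hL.factorial ⟨s, [], by simp⟩ h⟩

/-- Every word reappears to the right of any word. -/
lemma exists_right (hL : RecurrentLanguage L) {u w : List A} (hu : u ∈ L) (hw : w ∈ L) :
    ∃ x : List A, w ++ x ++ u ∈ L := by
  obtain ⟨K, hK⟩ := hL.recurrent hu
  obtain ⟨a, ha, h⟩ := hL.extend_right hw K
  obtain ⟨s, t, rfl⟩ := hK a (hL.factorial ⟨w, [], by simp⟩ h) ha.ge
  exact ⟨s, hL.factorial ⟨[], t, by simp⟩ h⟩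

/-- A single length works for all words of a given length. -/
lemma recurrent_length [Finite A] (hL : RecurrentLanguage L) (n : ℕ) :
    ∃ K : ℕ, ∀ u ∈ L, u.length = n → ∀ v ∈ L, K ≤ v.length → u <:+: v := by
  have hfin : {u : List A | u.length = n}.Finite := List.finite_length_eq A n
  have : ∀ u : List A, ∃ K : ℕ, u ∈ L → ∀ v ∈ L, K ≤ v.length → u <:+: v := by
    intro u
    by_cases hu : u ∈ L
    · obtain ⟨K, hK⟩ := hL.recurrent hu
      exact ⟨K, fun _ => hK⟩
    · exact ⟨0, fun h => absurd h hu⟩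
  choose K hK using this
  obtain ⟨M, hM⟩ := (hfin.image K).bddAbove
  exact ⟨M, fun u hu hn v hv hv' =>
    hK u hu v hv ((hM (Set.mem_image_of_mem K hn)).trans hv')⟩

/-- The complexity is unbounded: a list of `q` words cannot contain all the words of `L` of
length `n` unless `n ≤ q`. -/
lemma le_of_image (hL : RecurrentLanguage L) {n q : ℕ} (f : ℕ → List A)
    (h : ∀ u ∈ L, u.length = n → ∃ j < q, f j = u) : n ≤ q := by
  refine (hL.le_complexity n).trans ?_
  have hsub : {w : List A | w ∈ L ∧ w.length = n} ⊆ f '' (Finset.range q : Set ℕ) := by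
    rintro w ⟨hw, hn⟩
    obtain ⟨j, hj, hj'⟩ := h w hw hn
    exact ⟨j, by simpa using hj, hj'⟩
  calc complexity L n ≤ (f '' (Finset.range q : Set ℕ)).ncard :=
        Set.ncard_le_ncard hsub (Set.toFinite _)
    _ ≤ (Finset.range q : Set ℕ).ncard := Set.ncard_image_le (Set.toFinite _)
    _ = q := by rw [Set.ncard_coe_finset]; simp

end RecurrentLanguage

end Recurrence

/-! ### Return words and decompositions into blocks -/

section ReturnWords

variable {A α : Type}

/-- `w` is a return word to `u`: the word `u ++ w` is in `L` and has exactly two occurrences of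
`u`, as a prefix and as a suffix. -/
structure IsReturn (L : Set (List A)) (u w : List A) : Prop where
  ne_nil : w ≠ []
  mem : u ++ w ∈ L
  suffix : u <:+ u ++ w
  eq_of_prefix : ∀ w', w' <+: w → w' ≠ [] → u <:+ u ++ w' → w' = w

/-- `R` enumerates without repetition the return words to `u`. -/
structure IsReturnCoding (L : Set (List A)) (u : List A) (R : α → List A) : Prop where
  isReturn : ∀ a, IsReturn L u (R a)
  injective : Function.Injective R
  surjective : ∀ w, IsReturn L u w → ∃ a, R a = w

/-- Every word whose prolongation of `u` ends with `u` is a concatenation of return words. -/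
lemma IsReturnCoding.encode {L : Set (List A)} {u : List A} {R : α → List A}
    (hR : IsReturnCoding L u R) (hL : ∀ {v w : List A}, v <:+: w → w ∈ L → v ∈ L)
    {w : List A} (hw : u ++ w ∈ L) (hs : u <:+ u ++ w) : ∃ l : List α, w = l.flatMap R := by
  classical
  induction hn : w.length using Nat.strong_induction_on generalizing w with
  | _ n ih =>
    by_cases hw0 : w = []
    · exact ⟨[], by simpa using hw0⟩
    have hex : ∃ k, 0 < k ∧ k ≤ w.length ∧ u <:+ u ++ w.take k :=
      ⟨w.length, List.length_pos_iff.2 hw0, le_rfl, by simpa using hs⟩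
    obtain ⟨hk0, hkw, hks⟩ := Nat.find_spec hex
    set k := Nat.find hex with hk
    have hmem : u ++ w.take k ∈ L := by
      refine hL ⟨[], w.drop k, ?_⟩ hw
      simp [List.append_assoc]
    have hret : IsReturn L u (w.take k) := by
      refine ⟨?_, hmem, hks, ?_⟩
      · intro h
        have := congrArg List.length h
        simp only [List.length_take, List.length_nil] at this
        omega
      · intro w' hw' hne hsuf
        have hlen : w'.length ≤ k := hw'.length_le.trans (by simp)
        have heq : w' = w.take w'.length := by
          have := List.prefix_iff_eq_take.1 (hw'.trans (List.take_prefix k w))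
          exact this
        have hge : k ≤ w'.length :=
          Nat.find_min' hex ⟨List.length_pos_iff.2 hne, hlen.trans hkw, by rwa [← heq]⟩
        rw [heq, le_antisymm hlen hge]
    obtain ⟨a, ha⟩ := hR.surjective _ hret
    obtain ⟨y, hy⟩ := hks
    have hdecomp : u ++ w = y ++ (u ++ w.drop k) := by
      rw [← List.append_assoc, hy, List.append_assoc, List.take_append_drop]
    have hmem' : u ++ w.drop k ∈ L := hL ⟨y, [], by simp [hdecomp]⟩ hw
    have hs' : u <:+ u ++ w.drop k :=
      List.suffix_of_suffix_length_le hs ⟨y, hdecomp.symm⟩ (by simp)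
    obtain ⟨l, hl⟩ := ih (w.drop k).length (by simp only [List.length_drop]; omega) hmem' hs' rfl
    refine ⟨a :: l, ?_⟩
    rw [List.flatMap_cons, ha, ← hl, List.take_append_drop]

/-- In a concatenation of return words to `u` the occurrences of `u` end at the boundaries between
the return words. -/
lemma IsReturnCoding.decode {L : Set (List A)} {u : List A} {R : α → List A}
    (hR : IsReturnCoding L u R) {l : List α} {x y : List A} (hx : x ++ y = l.flatMap R)
    (hs : u <:+ u ++ x) : ∃ l₁ l₂, l = l₁ ++ l₂ ∧ x = l₁.flatMap R ∧ y = l₂.flatMap R := by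
  induction l generalizing x with
  | nil =>
    simp only [List.flatMap_nil, List.append_eq_nil_iff] at hx
    exact ⟨[], [], by simp, by simp [hx.1], by simp [hx.2]⟩
  | cons a l ih =>
    by_cases hx0 : x = []
    · subst hx0
      exact ⟨[], a :: l, by simp, by simp, by simpa using hx⟩
    rw [List.flatMap_cons] at hx
    have key : ∃ x', x = R a ++ x' := by
      rcases List.append_eq_append_iff.1 hx with ⟨s, hs1, hs2⟩ | ⟨s, hs1, hs2⟩
      · have := (hR.isReturn a).eq_of_prefix x ⟨s, hs1.symm⟩ hx0 hs
        exact ⟨[], by simp [this]⟩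
      · exact ⟨s, hs1⟩
    obtain ⟨x', rfl⟩ := key
    rw [List.append_assoc, List.append_right_inj] at hx
    obtain ⟨z, hz⟩ := (hR.isReturn a).suffix
    have hs' : u <:+ u ++ x' := by
      refine List.suffix_of_suffix_length_le hs ⟨z, ?_⟩ (by simp)
      rw [← List.append_assoc, hz, List.append_assoc]
    obtain ⟨l₁, l₂, h1, h2, h3⟩ := ih hx hs'
    exact ⟨a :: l₁, l₂, by simp [h1], by simp [h2], h3⟩

lemma IsReturnCoding.suffix_flatMap {A α : Type} {L : Set (List A)} {u : List A} {R : α → List A}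
    (hR : IsReturnCoding L u R) (l : List α) : u <:+ u ++ l.flatMap R := by
  induction l with
  | nil => simp
  | cons a l ih =>
    obtain ⟨y, hy⟩ := (hR.isReturn a).suffix
    refine ih.trans ⟨y, ?_⟩
    rw [List.flatMap_cons, ← List.append_assoc, hy, List.append_assoc]

lemma IsReturnCoding.mem_of_infix {L : Set (List A)} {u : List A} {R : α → List A}
    (hR : IsReturnCoding L u R) {l : List α} {a : α} (h : u ++ R a <:+: l.flatMap R) :
    a ∈ l := by
  obtain ⟨x, y, hxy⟩ := h
  obtain ⟨l₁, l₂, rfl, h1, h2⟩ := hR.decode (x := x ++ u) (y := R a ++ y) (l := l)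
    (by rw [← hxy]; simp) ⟨u ++ x, by simp⟩
  obtain ⟨l₃, l₄, rfl, h3, -⟩ := hR.decode h2 (hR.isReturn a).suffix
  cases l₃ with
  | nil => exact absurd (by simpa using h3) (hR.isReturn a).ne_nil
  | cons b l₃ =>
    rw [List.flatMap_cons] at h3
    have := (hR.isReturn a).eq_of_prefix (R b) ⟨_, h3.symm⟩ (hR.isReturn b).ne_nil
      (hR.isReturn b).suffix
    simp [hR.injective this]

/-- A word ends with at most one complete return to `u`. -/
lemma IsReturnCoding.eq_of_suffix {L : Set (List A)} {u s : List A} {R : α → List A}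
    (hR : IsReturnCoding L u R) {a b : α} (ha : u ++ R a <:+ s) (hb : u ++ R b <:+ s) : a = b := by
  have key : ∀ a b, u ++ R a <:+ u ++ R b → a = b := by
    intro a b hab
    have hle := hab.length_le
    simp only [List.length_append] at hle
    obtain ⟨y, hy⟩ : R a <:+ R b := by
      have h1 : R a <:+ u ++ R b := (List.suffix_append _ _).trans hab
      exact List.suffix_of_suffix_length_le h1 (List.suffix_append _ _) (by omega)
    have hsuf : u <:+ u ++ y := by
      rw [← hy, ← List.append_assoc] at hab
      obtain ⟨t, ht⟩ := hab
      rw [← List.append_assoc] at ht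
      exact ⟨t, List.append_cancel_right ht⟩
    by_cases hy0 : y = []
    · subst hy0
      exact hR.injective (by simpa using hy)
    · have h2 := (hR.isReturn b).eq_of_prefix y ⟨_, hy⟩ hy0 hsuf
      rw [← hy] at h2
      exact absurd (List.self_eq_append_right.1 h2) (hR.isReturn a).ne_nil
  rcases List.suffix_or_suffix_of_suffix ha hb with h | h
  · exact key a b h
  · exact (key b a h).symm

/-- Long words have long return words: a word with a short return to itself has a short period,
hence few factors of a given length. -/
lemma RecurrentLanguage.le_length_return {L : Set (List A)} (hL : RecurrentLanguage L)
    {K : ℕ} {u w : List A} (hu : ∀ v ∈ L, v.length = K → v <:+: u) (hw : w ≠ [])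
    (hs : u <:+ u ++ w) : K ≤ w.length := by
  obtain ⟨y, hy⟩ := hs
  have hyw : y.length = w.length := by
    have := congrArg List.length hy
    simp only [List.length_append] at this
    omega
  refine hL.le_of_image (fun j => (u.drop j).take K) fun v hv hK => ?_
  have hw' : 0 < w.length := List.length_pos_iff.2 hw
  obtain ⟨s, t, hst⟩ := hu v hv hK
  induction hn : s.length using Nat.strong_induction_on generalizing s t with
  | _ n ih =>
    by_cases hlt : n < w.length
    · refine ⟨n, hlt, ?_⟩
      simp [← hst, ← hn, ← hK]
    · -- shift the occurrence of `v` by one period to the left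
      have hlen : y.length ≤ s.length := by omega
      have h1 : y <+: u ++ w := ⟨u, hy⟩
      have h2 : s <+: u ++ w := ⟨v ++ t ++ w, by rw [← hst]; simp⟩
      obtain ⟨s', rfl⟩ := List.prefix_of_prefix_length_le h1 h2 hlen
      have h3 : y ++ u = y ++ (s' ++ v ++ (t ++ w)) := by
        rw [hy]
        conv_lhs => rw [← hst]
        simp
      have h4 := List.append_cancel_left h3
      simp only [List.length_append] at hn
      exact ih s'.length (by omega) s' (t ++ w) h4.symm rfl

/-! ### Factors of concatenations of blocks -/

/-- A word shorter than a common suffix `z` of the blocks meets at most two blocks. -/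
lemma infix_of_infix_flatMap {R : α → List A} {z v : List A} {l : List α} (hl : l ≠ [])
    (hz : ∀ a ∈ l, z <:+ R a) (hv : v.length ≤ z.length) (h : v <:+: l.flatMap R) :
    ∃ a ∈ l, v <:+: z ++ R a := by
  induction l with
  | nil => exact absurd rfl hl
  | cons a l ih =>
    rw [List.flatMap_cons, List.infix_append_iff] at h
    rcases h with h | h | ⟨v₁, v₂, rfl, h1, h2⟩
    · exact ⟨a, by simp, h.trans (List.suffix_append _ _).isInfix⟩
    · cases l with
      | nil =>
        rw [List.flatMap_nil, List.infix_nil] at h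
        exact ⟨a, by simp, by simp [h]⟩
      | cons b l =>
        obtain ⟨c, hc, h'⟩ := ih (by simp) (fun c hc => hz c (by simp [hc])) h
        exact ⟨c, by simp [hc], h'⟩
    · simp only [List.length_append] at hv
      cases l with
      | nil =>
        rw [List.flatMap_nil, List.prefix_nil] at h2
        subst h2
        exact ⟨a, by simp, by
          simpa using h1.isInfix.trans (List.suffix_append _ _).isInfix⟩
      | cons b l =>
        refine ⟨b, by simp, ?_⟩
        have hv1 : v₁ <:+ z :=
          List.suffix_of_suffix_length_le h1 (hz a (by simp)) (by omega)
        have hzb := (hz b (by simp)).length_le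
        have hv2 : v₂ <+: R b := by
          rw [List.flatMap_cons] at h2
          exact List.prefix_of_prefix_length_le h2 (List.prefix_append _ _) (by omega)
        obtain ⟨s, rfl⟩ := hv1
        obtain ⟨t, ht⟩ := hv2
        exact ⟨s, t, by rw [← ht]; simp⟩

/-- A word at least twice as long as the blocks contains a block. -/
lemma exists_infix_of_long {R : α → List A} {v : List A} {K : ℕ} (hK : 0 < K) {l : List α}
    (hR : ∀ a ∈ l, (R a).length ≤ K) (hv : 2 * K ≤ v.length) (h : v <:+: l.flatMap R) :
    ∃ a ∈ l, R a <:+: v := by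
  induction l with
  | nil =>
    have := h.length_le
    simp only [List.flatMap_nil, List.length_nil] at this
    omega
  | cons a l ih =>
    rw [List.flatMap_cons, List.infix_append_iff] at h
    have ha := hR a (by simp)
    rcases h with h | h | ⟨v₁, v₂, rfl, h1, h2⟩
    · have := h.length_le
      omega
    · obtain ⟨b, hb, h'⟩ := ih (fun b hb => hR b (by simp [hb])) h
      exact ⟨b, by simp [hb], h'⟩
    · have h1' := h1.length_le
      simp only [List.length_append] at hv
      cases l with
      | nil =>
        have := h2.length_le
        simp only [List.flatMap_nil, List.length_nil] at this
        omega
      | cons b l =>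
        rw [List.flatMap_cons] at h2
        have hb := hR b (by simp)
        have : R b <+: v₂ :=
          List.prefix_of_prefix_length_le (List.prefix_append _ _) h2 (by omega)
        exact ⟨b, by simp, this.isInfix.trans (List.suffix_append _ _).isInfix⟩

lemma length_le_length_flatMap {R : α → List A} {l : List α} {a : α} (ha : a ∈ l) :
    (R a).length ≤ (l.flatMap R).length := by
  obtain ⟨s, t, rfl⟩ := List.append_of_mem ha
  simp only [List.flatMap_append, List.flatMap_cons, List.length_append]
  omega

/-! ### Bispecial words -/

/-- Every right special word is a suffix of a bispecial word: otherwise its extensions to the left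
would be unique, and the complexity bounded. -/
lemma RecurrentLanguage.exists_bispecial {L : Set (List A)} (hL : RecurrentLanguage L)
    {u : List A} (hu : IsRightSpecial L u) : ∃ v, IsBispecial L v ∧ u <:+ v := by
  by_contra! hcon
  have key : ∀ k, ∃ a : List A, a.length = k ∧ IsRightSpecial L (a ++ u) ∧
      ∀ x : List A, x.length = k → x ++ u ∈ L → x = a := by
    intro k
    induction k with
    | zero =>
      exact ⟨[], rfl, by simpa using hu, fun x hx _ => List.length_eq_zero_iff.1 hx⟩
    | succ k ih =>
      obtain ⟨a, hak, has, hau⟩ := ih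
      have hnl : ¬ IsLeftSpecial L (a ++ u) := fun h => hcon _ ⟨has, h⟩ (List.suffix_append _ _)
      have huniq : ∀ c d : A, c :: (a ++ u) ∈ L → d :: (a ++ u) ∈ L → c = d := by
        intro c d hc hd
        by_contra hne
        exact hnl ⟨has.1, c, d, hne, hc, hd⟩
      obtain ⟨x, hx, hmem⟩ := hL.extend_left has.1 1
      obtain ⟨c, rfl⟩ := List.length_eq_one_iff.1 hx
      have hext : ∀ b, a ++ u ++ [b] ∈ L → c :: (a ++ u) ++ [b] ∈ L := by
        intro b hb
        obtain ⟨y, hy, hmem'⟩ := hL.extend_left hb 1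
        obtain ⟨d, rfl⟩ := List.length_eq_one_iff.1 hy
        have : d :: (a ++ u) ∈ L := hL.factorial ⟨[], [b], by simp⟩ hmem'
        rw [huniq c d hmem this]
        simpa using hmem'
      obtain ⟨-, b, b', hbb, hb, hb'⟩ := has
      refine ⟨c :: a, by simp [hak], ⟨hmem, b, b', hbb, hext b hb, hext b' hb'⟩, ?_⟩
      intro y hy hyu
      cases y with
      | nil => simp at hy
      | cons d y =>
        have hya : y = a := hau y (by simpa using hy) (hL.factorial ⟨[d], [], by simp⟩ hyu)
        subst hya
        rw [huniq c d hmem hyu]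
  -- every word `w` of length `M + 2` is followed by `u` after at most `M` letters, hence is one of
  -- `M + 1` factors of the only word `a` of length `M + 2 + M` that can precede `u`
  obtain ⟨M, hM⟩ := hL.recurrent hu.1
  obtain ⟨a, ha, -, hau⟩ := key (M + 2 + M)
  have := hL.le_of_image (n := M + 2) (q := M + 1)
    (fun j => (a.drop (M - j)).take (M + 2)) (by
      intro w hw hwl
      obtain ⟨y, hy, hwy⟩ := hL.extend_right hw M
      obtain ⟨s, t, hst⟩ := hM y (hL.factorial ⟨w, [], by simp⟩ hwy) hy.ge
      have hsM : s.length ≤ M := by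
        rw [← hy, ← hst]
        simp only [List.length_append]
        omega
      have hmem : w ++ s ++ u ∈ L := hL.factorial ⟨[], t, by simp [← hst]⟩ hwy
      obtain ⟨x, hx, hmem'⟩ := hL.extend_left hmem (M - s.length)
      have hxa : x ++ w ++ s = a := by
        apply hau
        · simp only [List.length_append]
          omega
        · simpa using hmem'
      refine ⟨s.length, by omega, ?_⟩
      simp [← hxa, ← hx, ← hwl])
  omega

end ReturnWords

/-! ### Paths of Rauzy graphs and their labels -/

section Paths

variable {A : Type}

/-- The path of the Rauzy graph that starts from the vertex `u` and has right label `w`. -/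
def pathOf (u : List A) : List A → List (List A)
  | [] => []
  | a :: w => (u ++ [a]) :: pathOf (u ++ [a]).tail w

@[simp] lemma rightLabel_pathOf (u w : List A) : rightLabel (pathOf u w) = w := by
  induction w generalizing u with
  | nil => rfl
  | cons a w ih =>
    have := ih (u ++ [a]).tail
    unfold rightLabel at this ⊢
    simp [pathOf, this]

lemma rightLabel_flatMap {α : Type} (l : List α) (f : α → List (List A)) :
    rightLabel (l.flatMap f) = l.flatMap fun a => rightLabel (f a) := by
  induction l with
  | nil => rfl
  | cons a l ih =>
    unfold rightLabel at ih ⊢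
    simp [List.flatMap_cons, List.filterMap_append, ih]

lemma IsPath.length_of_mem {L : Set (List A)} {n : ℕ} {u v : List A} {p : List (List A)}
    (h : IsPath L n u p v) : ∀ e ∈ p, e.length = n + 1 := by
  induction h with
  | nil => simp
  | cons e p v he hn hp ih =>
    intro f hf
    rcases List.mem_cons.1 hf with rfl | hf
    · exact hn
    · exact ih f hf

/-- A path is determined by its first vertex and its right label. -/
lemma IsPath.eq_pathOf {L : Set (List A)} {n : ℕ} {u v : List A} {p : List (List A)}
    (h : IsPath L n u p v) : u.length = n ∧ v.length = n ∧ p = pathOf u (rightLabel p) ∧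
      v <:+ u ++ rightLabel p := by
  induction h with
  | nil u hu hn => exact ⟨hn, hn, rfl, by simp [rightLabel]⟩
  | cons e p v he hn hp ih =>
    obtain ⟨-, h2, h3, h4⟩ := ih
    have hne : e ≠ [] := by
      rintro rfl
      simp at hn
    have hlab : rightLabel (e :: p) = e.getLast hne :: rightLabel p := by
      simp [rightLabel, List.getLast?_eq_some_getLast hne]
    have hcat : e.dropLast ++ [e.getLast hne] = e := List.dropLast_append_getLast hne
    refine ⟨by simp [hn], h2, ?_, ?_⟩
    · rw [hlab, pathOf, hcat, ← h3]
    · rw [hlab, List.append_cons, hcat]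
      refine h4.trans ?_
      cases e with
      | nil => exact absurd rfl hne
      | cons a e => exact ⟨[a], by simp⟩

lemma isPath_pathOf {L : Set (List A)} (hL : ∀ {v w : List A}, v <:+: w → w ∈ L → v ∈ L)
    {n : ℕ} {u w : List A} (hu : u.length = n) (h : u ++ w ∈ L) :
    ∃ v, IsPath L n u (pathOf u w) v := by
  induction w generalizing u with
  | nil => exact ⟨u, IsPath.nil u (by simpa using h) hu⟩
  | cons a w ih =>
    obtain ⟨b, t, hbt⟩ : ∃ b t, u ++ [a] = b :: t := by
      cases u with
      | nil => exact ⟨a, [], rfl⟩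
      | cons b u => exact ⟨b, u ++ [a], rfl⟩
    have hcat : (u ++ [a]) ++ w ∈ L := by simpa using h
    have htail : (u ++ [a]).tail ++ w ∈ L := by
      refine hL ⟨[b], [], ?_⟩ hcat
      rw [hbt]
      simp
    obtain ⟨v, hv⟩ := ih (u := (u ++ [a]).tail) (by simp [hu]) htail
    have := IsPath.cons (u ++ [a]) _ v (hL ⟨[], w, by simp⟩ hcat) (by simp [hu]) hv
    rw [List.dropLast_concat] at this
    exact ⟨v, this⟩

lemma tail_append_suffix (x : List A) (a : A) (w : List A) :
    (x ++ [a]).tail ++ w <:+ x ++ a :: w := by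
  cases x with
  | nil => exact ⟨[a], rfl⟩
  | cons b x => exact ⟨[b], by simp⟩

/-- The first vertices of the edges of a path are read at the end of the proper prefixes of its
full label. -/
lemma exists_dropLast_pathOf {d x w : List A} :
    (∃ e ∈ pathOf x w, e.dropLast = d) ↔
      ∃ w' c, w' ++ [c] <+: w ∧ d.length = x.length ∧ d <:+ x ++ w' := by
  induction w generalizing x with
  | nil => simp [pathOf]
  | cons a w ih =>
    have hxa : (x ++ [a]).tail.length = x.length := by simp
    constructor
    · rintro ⟨e, he, rfl⟩
      rcases List.mem_cons.1 he with rfl | he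
      · exact ⟨[], a, by simp, by simp, by simp⟩
      · obtain ⟨w', c, h1, h2, h3⟩ := ih.1 ⟨e, he, rfl⟩
        refine ⟨a :: w', c, by simpa using h1, h2.trans hxa, h3.trans (tail_append_suffix x a w')⟩
    · rintro ⟨w', c, h1, h2, h3⟩
      cases w' with
      | nil =>
        refine ⟨x ++ [a], by simp [pathOf], ?_⟩
        rw [List.append_nil] at h3
        rw [List.dropLast_concat]
        exact (h3.eq_of_length h2).symm
      | cons b w' =>
        obtain ⟨rfl, h5⟩ : b = a ∧ w' ++ [c] <+: w := by simpa using h1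
        have h4 : d <:+ (x ++ [b]).tail ++ w' := 
          List.suffix_of_suffix_length_le h3 (tail_append_suffix x b w')
            (by rw [List.length_append, hxa, h2]; omega)
        obtain ⟨e, he, hed⟩ := ih.2 ⟨w', c, h5, h2.trans hxa.symm, h4⟩
        exact ⟨e, by simp [pathOf, he], hed⟩

/-- The allowed circuits from `u` are the paths from `u` labelled by the return words to `u`. -/
lemma isAllowedCircuit_iff {L : Set (List A)}
    (hL : ∀ {v w : List A}, v <:+: w → w ∈ L → v ∈ L) {n : ℕ} {u : List A}
    (hu : IsRightSpecial L u) (hn : u.length = n) {q : List (List A)} :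
    IsAllowedCircuit L n u q ↔ IsReturn L u (rightLabel q) ∧ q = pathOf u (rightLabel q) := by
  -- the interior vertices of the path labelled by `w`
  have hint : ∀ w : List A, (∀ e ∈ (pathOf u w).tail, e.dropLast ≠ u) ↔
      ∀ w', w' <+: w → w' ≠ [] → u <:+ u ++ w' → w' = w := by
    intro w
    cases w with
    | nil => simp [pathOf]
    | cons a w =>
      have hxa : (u ++ [a]).tail.length = u.length := by simp
      have hsuf : ∀ w' : List A, (u <:+ (u ++ [a]).tail ++ w' ↔ u <:+ u ++ a :: w') := by
        intro w'
        have h0 := tail_append_suffix u a w'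
        exact ⟨fun h => h.trans h0, fun h => List.suffix_of_suffix_length_le h h0
          (by rw [List.length_append, hxa]; omega)⟩
      have hex := exists_dropLast_pathOf (d := u) (x := (u ++ [a]).tail) (w := w)
      simp only [hxa, true_and, hsuf] at hex
      have htail : (pathOf u (a :: w)).tail = pathOf (u ++ [a]).tail w := rfl
      rw [htail]
      constructor
      · intro h w' hw' hne hs
        cases w' with
        | nil => exact absurd rfl hne
        | cons b w' =>
          obtain ⟨rfl, h1⟩ : b = a ∧ w' <+: w := by simpa using hw'
          obtain ⟨t, rfl⟩ := h1
          cases t with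
          | nil => simp
          | cons c t =>
            obtain ⟨e, he, hed⟩ := hex.2 ⟨w', c, ⟨t, by simp⟩, hs⟩
            exact absurd hed (h e he)
      · intro h e he hed
        obtain ⟨w', c, h1, h2⟩ := hex.1 ⟨e, he, hed⟩
        have h3 := h (a :: w') (by
          simpa using (List.prefix_append w' [c]).trans h1) (by simp) h2
        have h4 := h1.length_le
        simp only [List.cons.injEq, true_and] at h3
        simp [h3] at h4
  constructor
  · rintro ⟨-, hp, hne, hi, hmem⟩
    obtain ⟨-, -, h3, h4⟩ := hp.eq_pathOf
    refine ⟨⟨?_, hmem, h4, ?_⟩, h3⟩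
    · intro h
      rw [h] at h3
      exact hne h3
    · rw [h3] at hi
      exact (hint _).1 hi
  · rintro ⟨⟨h1, h2, h3, h4⟩, h5⟩
    obtain ⟨v, hv⟩ := isPath_pathOf hL hn h2
    obtain ⟨-, hvn, -, hvs⟩ := hv.eq_pathOf
    rw [rightLabel_pathOf] at hvs
    have hvu : v = u := by
      rcases List.suffix_or_suffix_of_suffix hvs h3 with h | h
      · exact h.eq_of_length (hvn.trans hn.symm)
      · exact (h.eq_of_length (hn.trans hvn.symm)).symm
    rw [hvu, ← h5] at hv
    refine ⟨hu, hv, ?_, ?_, h2⟩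
    · intro h
      rw [h] at h1
      exact h1 rfl
    · rw [h5]
      exact (hint _).2 h4

lemma psi_iterate (k : ℕ) (p : List (List A)) : psi^[k] p = p.map (List.drop k) := by
  induction k generalizing p with
  | zero => exact (List.map_id p).symm
  | succ k ih =>
    rw [Function.iterate_succ_apply, ih, psi, List.map_map]
    congr 1
    ext1 e
    simp [List.drop_tail]

lemma rightLabel_psi_iterate {k : ℕ} {p : List (List A)} (h : ∀ e ∈ p, k < e.length) :
    rightLabel (psi^[k] p) = rightLabel p := by
  rw [psi_iterate]
  unfold rightLabel
  rw [List.filterMap_map]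
  apply List.filterMap_congr
  intro e he
  simp [List.getLast?_drop, Nat.not_le.2 (h e he)]

end Paths

/-! ### Dependence on the short words of the language -/

section Locality

variable {A : Type}

/-- The two languages have the same words of length at most `m`. -/
def AgreeUpTo (m : ℕ) (L L' : Set (List A)) : Prop :=
  ∀ w : List A, w.length ≤ m → (w ∈ L ↔ w ∈ L')

lemma AgreeUpTo.symm {m : ℕ} {L L' : Set (List A)} (h : AgreeUpTo m L L') : AgreeUpTo m L' L :=
  fun w hw => (h w hw).symm

lemma AgreeUpTo.mono {m n : ℕ} {L L' : Set (List A)} (h : AgreeUpTo m L L') (hn : n ≤ m) :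
    AgreeUpTo n L L' :=
  fun w hw => h w (hw.trans hn)

lemma AgreeUpTo.isRightSpecial {m : ℕ} {L L' : Set (List A)} (h : AgreeUpTo m L L') {u : List A}
    (hu : u.length + 1 ≤ m) : IsRightSpecial L u ↔ IsRightSpecial L' u := by
  have h2 : ∀ a : A, (u ++ [a] ∈ L ↔ u ++ [a] ∈ L') := fun a => h _ (by simpa using hu)
  simp only [IsRightSpecial, h u (by omega), h2]

lemma AgreeUpTo.isLeftSpecial {m : ℕ} {L L' : Set (List A)} (h : AgreeUpTo m L L') {u : List A}
    (hu : u.length + 1 ≤ m) : IsLeftSpecial L u ↔ IsLeftSpecial L' u := by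
  have h2 : ∀ a : A, (a :: u ∈ L ↔ a :: u ∈ L') := fun a => h _ (by simpa using hu)
  simp only [IsLeftSpecial, h u (by omega), h2]

lemma AgreeUpTo.isBispecial {m : ℕ} {L L' : Set (List A)} (h : AgreeUpTo m L L') {u : List A}
    (hu : u.length + 1 ≤ m) : IsBispecial L u ↔ IsBispecial L' u := by
  simp only [IsBispecial, h.isRightSpecial hu, h.isLeftSpecial hu]

lemma AgreeUpTo.isSpecial {m : ℕ} {L L' : Set (List A)} (h : AgreeUpTo m L L') {u : List A}
    (hu : u.length + 1 ≤ m) : IsSpecial L u ↔ IsSpecial L' u := by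
  simp only [IsSpecial, h.isRightSpecial hu, h.isLeftSpecial hu]

lemma AgreeUpTo.complexity_eq {m : ℕ} {L L' : Set (List A)} (h : AgreeUpTo m L L') {n : ℕ}
    (hn : n ≤ m) : complexity L n = complexity L' n := by
  unfold complexity
  congr 1
  ext w
  constructor
  · rintro ⟨h1, h2⟩
    exact ⟨(h w (h2 ▸ hn)).1 h1, h2⟩
  · rintro ⟨h1, h2⟩
    exact ⟨(h w (h2 ▸ hn)).2 h1, h2⟩

lemma AgreeUpTo.isReducedVertex {n : ℕ} {L L' : Set (List A)} (h : AgreeUpTo (n + 1) L L')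
    {u : List A} : IsReducedVertex L n u ↔ IsReducedVertex L' n u := by
  have key : u.length = n → ((u ∈ L ∧ (IsSpecial L u ∨ IsBoundary L u)) ↔
      (u ∈ L' ∧ (IsSpecial L' u ∨ IsBoundary L' u))) := by
    intro hu
    have h2 : ∀ a : A, (u ++ [a] ∈ L ↔ u ++ [a] ∈ L') := fun a => h _ (by simp [hu])
    have h3 : ∀ a : A, (a :: u ∈ L ↔ a :: u ∈ L') := fun a => h _ (by simp [hu])
    rw [h u (by omega), h.isSpecial (by omega)]
    simp only [IsBoundary, h2, h3]
  unfold IsReducedVertex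
  tauto

lemma IsPath.of_agreeUpTo {n : ℕ} {L L' : Set (List A)} (h : AgreeUpTo (n + 1) L L')
    {u v : List A} {p : List (List A)} (hp : IsPath L n u p v) : IsPath L' n u p v := by
  induction hp with
  | nil u hu hn => exact IsPath.nil u ((h u (by omega)).1 hu) hn
  | cons e p v he hn hp ih => exact IsPath.cons e p v ((h e hn.le).1 he) hn ih

/-- The edge of the reduced Rauzy graph of `L'` that corresponds to an edge of that of `L`. -/
def ReducedEdge.transfer {n : ℕ} {L L' : Set (List A)} (h : AgreeUpTo (n + 1) L L')
    (e : ReducedEdge L n) : ReducedEdge L' n where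
  path := e.path
  src := ⟨e.src.1, h.isReducedVertex.1 e.src.2⟩
  tgt := ⟨e.tgt.1, h.isReducedVertex.1 e.tgt.2⟩
  isPath := e.isPath.of_agreeUpTo h
  ne_nil := e.ne_nil
  interior := fun f hf => by
    have hlen := e.isPath.length_of_mem f (List.mem_of_mem_tail hf)
    rw [← h.isSpecial (by simp [hlen])]
    exact e.interior f hf

/-- The isomorphism between the reduced Rauzy graphs of two languages with the same short words. -/
def reducedRauzyGraphIso {n : ℕ} {L L' : Set (List A)} (h : AgreeUpTo (n + 1) L L') :
    MultiDigraph.Iso (reducedRauzyGraph L n) (reducedRauzyGraph L' n) where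
  onV := Equiv.subtypeEquivRight fun _ => h.isReducedVertex
  onE :=
    { toFun := ReducedEdge.transfer h
      invFun := ReducedEdge.transfer h.symm
      left_inv := fun _ => rfl
      right_inv := fun _ => rfl }
  src_eq := fun _ => rfl
  tgt_eq := fun _ => rfl

lemma FollowsProcedure.of_agreeUpTo {d c n : ℕ} {L L' : Set (List (Fin d))}
    (h : AgreeUpTo (n + 1) L L') {t : RauzyType} {U : List (Fin d)}
    {θ : Fin c → List (List (Fin d))} (hF : FollowsProcedure L n t U θ) :
    FollowsProcedure L' n t U θ := by
  obtain ⟨Φ, v, cs, h1, h2, h3, h4⟩ := hF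
  let Ψ := reducedRauzyGraphIso h
  exact ⟨⟨Φ.onV.trans Ψ.onV, Φ.onE.trans Ψ.onE,
    fun e => (Ψ.src_eq (Φ.onE e)).trans (congrArg Ψ.onV (Φ.src_eq e)),
    fun e => (Ψ.tgt_eq (Φ.onE e)).trans (congrArg Ψ.onV (Φ.tgt_eq e))⟩, v, cs, h1, h2, h3, h4⟩

lemma IsNaming.two_le_length {t : RauzyType} {v : (shape t).V} {cs : List (List (shape t).E)}
    (h : IsNaming t v cs) : 2 ≤ cs.length := by
  cases h
  case type3 h => exact (Nat.le_succ 2).trans_eq h.length_eq.symm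
  all_goals first
    | exact Nat.le_refl 2
    | exact Nat.le_succ 2
    | (rename_i h; rcases h with rfl | rfl
       · exact Nat.le_refl 2
       · exact Nat.le_succ 2)

lemma FollowsProcedure.two_le {d c n : ℕ} {L : Set (List (Fin d))} {t : RauzyType}
    {U : List (Fin d)} {θ : Fin c → List (List (Fin d))} (hF : FollowsProcedure L n t U θ) :
    2 ≤ c := by
  obtain ⟨Φ, v, cs, -, h2, h3, -⟩ := hF
  have := congrArg List.length h3
  rw [List.length_ofFn, List.length_map] at this
  rw [this]
  exact h2.two_le_length

end Locality

/-! ### Images of letters under compositions of morphisms -/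

section Images

lemma toList_hom {α β : Type} (f : FreeMonoid α →* FreeMonoid β) (w : FreeMonoid α) :
    FreeMonoid.toList (f w) =
      (FreeMonoid.toList w).flatMap fun a => FreeMonoid.toList (f (FreeMonoid.of a)) := by
  induction w using FreeMonoid.inductionOn' with
  | one => simp
  | of_mul a w ih => simp [map_mul, FreeMonoid.toList_mul, ih]

namespace MorphismSeq

variable (σ : MorphismSeq)

@[simp] lemma comp_self (r : ℕ) : σ.comp (le_refl r) = MonoidHom.id _ := Nat.leRec_self _ _

lemma comp_succ {r s : ℕ} (h : r ≤ s) :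
    σ.comp (h.trans s.le_succ) = (σ.comp h).comp (σ.mor s) :=
  Nat.leRec_succ _ _ h

lemma comp_trans {r s t : ℕ} (h₁ : r ≤ s) (h₂ : s ≤ t) :
    σ.comp (h₁.trans h₂) = (σ.comp h₁).comp (σ.comp h₂) := by
  induction t, h₂ using Nat.le_induction with
  | base => simp
  | succ t ht ih => rw [σ.comp_succ (h₁.trans ht), σ.comp_succ ht, ih]; rfl

/-- The word `σ_r ⋯ σ_{s-1}(b)` over the alphabet `A_r`. -/
def image {r s : ℕ} (h : r ≤ s) (b : Fin (σ.card s)) : List (Fin (σ.card r)) :=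
  FreeMonoid.toList (σ.comp h (FreeMonoid.of b))

/-- The word `σ_0 ⋯ σ_{n-1}(a)`; for a realized sequence, the right label of the circuit
`θ_n(a)`. -/
def word (n : ℕ) (a : Fin (σ.card n)) : List (Fin (σ.card 0)) := σ.image n.zero_le a

lemma image_trans {r s t : ℕ} (h₁ : r ≤ s) (h₂ : s ≤ t) (b : Fin (σ.card t)) :
    σ.image (h₁.trans h₂) b = (σ.image h₂ b).flatMap (σ.image h₁) := by
  unfold image
  rw [σ.comp_trans h₁ h₂, MonoidHom.comp_apply, toList_hom]

lemma word_eq_flatMap {s t : ℕ} (h : s ≤ t) (b : Fin (σ.card t)) :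
    σ.word t b = (σ.image h b).flatMap (σ.word s) :=
  σ.image_trans s.zero_le h b

lemma image_succ (n : ℕ) (a : Fin (σ.card (n + 1))) :
    σ.image n.le_succ a = FreeMonoid.toList (σ.mor n (FreeMonoid.of a)) := by
  have := σ.comp_succ (le_refl n)
  simp only [comp_self, MonoidHom.id_comp] at this
  unfold image
  rw [this]

lemma word_zero (a : Fin (σ.card 0)) : σ.word 0 a = [a] := by
  simp [word, image]

end MorphismSeq

end Images

/-! ### Realizations of initial segments of a labelled path -/

section PartialRealization

/-- A reading of the first `N` steps of `p` in the evolution of the Rauzy graphs of `X`: the data of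
`Realization`, where the circuits are prescribed for `n ≤ N` only. The alphabet of `X` may
be identified with that of `p` by an equality `hd` of cardinals. -/
structure PartialRealization (p : LabelledPath) (N : ℕ) {d : ℕ} (hd : d = p.label.card 0)
    (X : Subshift (Fin d) ℤ) where
  i : ℕ → ℕ
  i_strictMono : StrictMono i
  i_range : ∀ k, k ∈ Set.range i ↔ ∃ u, u.length = k ∧ IsBispecial (language X) u
  U : ℕ → List (Fin d)
  U_length : ∀ n, (U n).length = n
  U_rightSpecial : ∀ n, IsRightSpecial (language X) (U n)
  U_suffix : ∀ n, U n <:+ U (n + 1)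
  θ : ∀ n, Fin (p.label.card n) → List (List (Fin d))
  θ_injective : ∀ n ≤ N, Function.Injective (θ n)
  θ_range : ∀ n ≤ N, ∀ q, q ∈ Set.range (θ n) ↔ IsAllowedCircuit (language X) (i n) (U (i n)) q
  θ_procedure : ∀ n ≤ N, FollowsProcedure (language X) (i n) (p.type n) (U (i n)) (θ n)
  θ_zero : ∀ a, rightLabel (θ 0 a) = [Fin.cast hd.symm a]
  label_eq : ∀ n < N, ∀ a, (FreeMonoid.toList (p.label.mor n (FreeMonoid.of a))).flatMap (θ n) =
    psi^[i (n + 1) - i n] (θ (n + 1) a)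

/-- A realization of a path is a realization of its initial segments. -/
def Realization.toPartial {p : LabelledPath} {X : Subshift (Fin (p.label.card 0)) ℤ}
    (r : Realization p X) (N : ℕ) : PartialRealization p N rfl X where
  i := r.i
  i_strictMono := r.i_strictMono
  i_range := r.i_range
  U := r.U
  U_length := r.U_length
  U_rightSpecial := r.U_rightSpecial
  U_suffix := r.U_suffix
  θ := r.θ
  θ_injective := fun n _ => r.θ_injective n
  θ_range := fun n _ => r.θ_range n
  θ_procedure := fun n _ => r.θ_procedure n
  θ_zero := r.θ_zero
  label_eq := fun n _ => r.label_eq n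

lemma FollowsProcedure.comp_cast {d c c' n : ℕ} {L : Set (List (Fin d))} {t : RauzyType}
    {U : List (Fin d)} {θ : Fin c → List (List (Fin d))} (h : FollowsProcedure L n t U θ)
    (hc : c' = c) : FollowsProcedure L n t U fun a => θ (Fin.cast hc a) := by
  subst hc
  exact h

lemma LabelledEdge.flatMap_mor {e e' : LabelledEdge} (h : e = e') (hd : e'.domCard = e.domCard)
    (hc : e'.codCard = e.codCard) {β : Type} (θ : Fin e.codCard → List β) (a : Fin e'.domCard) :
    ((FreeMonoid.toList (e'.mor (FreeMonoid.of a))).flatMap fun b => θ (Fin.cast hc b)) =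
      (FreeMonoid.toList (e.mor (FreeMonoid.of (Fin.cast hd a)))).flatMap θ := by
  subst h
  rfl

lemma LabelledPath.IsValidPrefix.exists_partialRealization {p : LabelledPath} {N : ℕ}
    (h : p.IsValidPrefix (N + 1)) :
    ∃ X : Subshift (Fin (p.label.card 0)) ℤ, InClass X ∧
      Nonempty (PartialRealization p N rfl X) := by
  obtain ⟨q, ⟨X, hX, ⟨r⟩⟩, hqp⟩ := h
  have hcard : ∀ k ≤ N, p.label.card k = q.label.card k := fun k hk =>
    (congrArg LabelledEdge.codCard (hqp k (by omega))).symm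
  have htype : ∀ k ≤ N, p.type k = q.type k := fun k hk =>
    (congrArg LabelledEdge.src (hqp k (by omega))).symm
  -- the alphabet of `X` equals that of `p` only propositionally: it is kept as a variable `d`, which
  -- is replaced at the end
  have hgen : ∃ (d : ℕ) (hd : d = p.label.card 0) (X : Subshift (Fin d) ℤ), InClass X ∧
      Nonempty (PartialRealization p N hd X) := by
    refine ⟨q.label.card 0, (hcard 0 N.zero_le).symm, X, hX, ⟨?_⟩⟩
    -- beyond `N` the circuits are irrelevant, and there need not be a cast
    let θ' : ∀ n, Fin (p.label.card n) → List (List (Fin (q.label.card 0))) := fun n a =>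
      if hn : n ≤ N then r.θ n (Fin.cast (hcard n hn) a) else []
    have hθ' : ∀ n (hn : n ≤ N), θ' n = fun a => r.θ n (Fin.cast (hcard n hn) a) := by
      intro n hn
      ext1 a
      simp only [θ', dif_pos hn]
    exact
      { i := r.i
        i_strictMono := r.i_strictMono
        i_range := r.i_range
        U := r.U
        U_length := r.U_length
        U_rightSpecial := r.U_rightSpecial
        U_suffix := r.U_suffix
        θ := θ'
        θ_injective := by
          intro n hn
          rw [hθ' n hn]
          exact (r.θ_injective n).comp (Fin.cast_injective _)
        θ_range := by
          intro n hn c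
          rw [← r.θ_range n c, hθ' n hn]
          constructor
          · rintro ⟨a, rfl⟩
            exact ⟨_, rfl⟩
          · rintro ⟨a, rfl⟩
            exact ⟨Fin.cast (hcard n hn).symm a, rfl⟩
        θ_procedure := by
          intro n hn
          rw [hθ' n hn, htype n hn]
          exact (r.θ_procedure n).comp_cast (hcard n hn)
        θ_zero := by
          intro a
          rw [hθ' 0 N.zero_le]
          exact r.θ_zero _
        label_eq := by
          intro n hn a
          rw [hθ' n hn.le, hθ' (n + 1) hn]
          exact (LabelledEdge.flatMap_mor (hqp n (by omega)) (hcard (n + 1) hn) (hcard n hn.le)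
            (r.θ n) a).trans (r.label_eq n _) }
  obtain ⟨d, hd, Y, hY, hr⟩ := hgen
  subst hd
  exact ⟨Y, hY, hr⟩

namespace PartialRealization

variable {p : LabelledPath} {N : ℕ} {X : Subshift (Fin (p.label.card 0)) ℤ}

/-- The right label of `θ_n(a)` is the image of the letter `a` under the labels of the first `n`
steps, since `ψ` preserves right labels. -/
lemma rightLabel_θ (r : PartialRealization p N rfl X) {n : ℕ} (hn : n ≤ N)
    (a : Fin (p.label.card n)) : rightLabel (r.θ n a) = p.label.word n a := by
  induction n with
  | zero => rw [r.θ_zero, MorphismSeq.word_zero]; rfl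
  | succ n ih =>
    have hlt : r.i n < r.i (n + 1) := r.i_strictMono n.lt_succ_self
    have hlen : ∀ e ∈ r.θ (n + 1) a, r.i (n + 1) - r.i n < e.length := by
      intro e he
      rw [((r.θ_range (n + 1) hn _).1 ⟨a, rfl⟩).2.1.length_of_mem e he]
      omega
    rw [← rightLabel_psi_iterate hlen, ← r.label_eq n hn, rightLabel_flatMap,
      p.label.word_eq_flatMap n.le_succ, p.label.image_succ]
    exact List.flatMap_congr fun b _ => ih (by omega) b

lemma θ_eq_pathOf (r : PartialRealization p N rfl X) {n : ℕ} (hn : n ≤ N)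
    (a : Fin (p.label.card n)) : r.θ n a = pathOf (r.U (r.i n)) (p.label.word n a) := by
  have := ((r.θ_range n hn _).1 ⟨a, rfl⟩).2.1.eq_pathOf.2.2.1
  rwa [r.rightLabel_θ hn] at this

/-- The words `σ_0 ⋯ σ_{n-1}(a)` are the return words to `U_{i_n}`. -/
lemma isReturnCoding (r : PartialRealization p N rfl X) {n : ℕ} (hn : n ≤ N) :
    IsReturnCoding (language X) (r.U (r.i n)) (p.label.word n) := by
  have hiff := fun q => isAllowedCircuit_iff (q := q) language_factorial
    (r.U_rightSpecial (r.i n)) (r.U_length _)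
  refine ⟨fun a => ?_, fun a b hab => ?_, fun w hw => ?_⟩
  · rw [← r.rightLabel_θ hn]
    exact ((hiff _).1 ((r.θ_range n hn _).1 ⟨a, rfl⟩)).1
  · apply r.θ_injective n hn
    rw [r.θ_eq_pathOf hn, r.θ_eq_pathOf hn, hab]
  · obtain ⟨a, ha⟩ := (r.θ_range n hn (pathOf (r.U (r.i n)) w)).2
      ((hiff _).2 ⟨by simpa using hw, by simp⟩)
    exact ⟨a, by rw [← r.rightLabel_θ hn, ha, rightLabel_pathOf]⟩

lemma U_suffix_of_le (r : PartialRealization p N rfl X) {m n : ℕ} (h : m ≤ n) :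
    r.U m <:+ r.U n := by
  induction n, h using Nat.le_induction with
  | base => exact List.suffix_rfl
  | succ n _ ih => exact ih.trans (r.U_suffix n)

lemma two_le_card (r : PartialRealization p N rfl X) {n : ℕ} (hn : n ≤ N) :
    2 ≤ p.label.card n :=
  (r.θ_procedure n hn).two_le

lemma image_ne_nil (r : PartialRealization p N rfl X) {s t : ℕ} (h : s ≤ t) (ht : t ≤ N)
    (b : Fin (p.label.card t)) : p.label.image h b ≠ [] := by
  intro h0
  have := ((r.isReturnCoding ht).isReturn b).ne_nil
  rw [p.label.word_eq_flatMap h, h0] at this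
  exact this rfl

end PartialRealization

end PartialRealization

/-! ### Valid paths have weakly primitive and eventually right proper labels -/

section Necessity

variable {p : LabelledPath} {X : Subshift (Fin (p.label.card 0)) ℤ}

/-- The return words to a long enough `U_{i_{s+1}}` are long, so each of them contains
`U_{i_r} σ_0 ⋯ σ_{r-1}(a)` for every letter `a` of `A_r`. -/
lemma Realization.weaklyPrimitive (R : Realization p X) (hX : InClass X) :
    p.label.WeaklyPrimitive := by
  intro m
  have hL := hX.recurrentLanguage
  have hC := fun n => (R.toPartial n).isReturnCoding le_rfl
  have hK : ∀ a, ∃ K, ∀ v ∈ language X, K ≤ v.length →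
      R.U (R.i m) ++ p.label.word m a <:+: v := fun a => hL.recurrent ((hC m).isReturn a).mem
  choose K hK using hK
  -- the sum of the `K a` stands for a common bound
  obtain ⟨M, hM⟩ := hL.recurrent_length (∑ a, K a)
  obtain ⟨s, hs⟩ : ∃ s, s = max (m + 1) M := ⟨_, rfl⟩
  refine ⟨s, by omega, fun a b => ?_⟩
  have hret := (hC (s + 1)).isReturn b
  have hlen : ∑ a, K a ≤ (p.label.word (s + 1) b).length := by
    refine hL.le_length_return (u := R.U (R.i (s + 1))) (fun v hv hvl => ?_) hret.ne_nil hret.suffix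
    refine hM v hv hvl _ (R.U_rightSpecial _).1 ?_
    rw [R.U_length]
    have := R.i_strictMono.le_apply (x := s + 1)
    omega
  have hmem : p.label.word (s + 1) b ∈ language X :=
    hL.factorial (List.suffix_append _ _).isInfix hret.mem
  have hinf := hK a _ hmem
    ((Finset.single_le_sum (fun _ _ => Nat.zero_le _) (Finset.mem_univ a)).trans hlen)
  rw [p.label.word_eq_flatMap (show m ≤ s + 1 by omega)] at hinf
  exact (hC m).mem_of_infix hinf

/-- All the words `σ_r ⋯ σ_{s-1}(b)` end with the same letter as soon as `U_{i_s}` is longer than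
the complete returns to `U_{i_r}`: this letter codes the last complete return in `U_{i_s}`. -/
lemma Realization.exists_common_last (R : Realization p X) (m : ℕ) :
    ∃ (s : ℕ) (h : m < s) (a : Fin (p.label.card m)), ∀ b : Fin (p.label.card s),
      ∃ l, p.label.image h.le b = l ++ [a] := by
  have hC := fun n => (R.toPartial n).isReturnCoding le_rfl
  -- since `s ≤ i_s`, this makes `U_{i_s}` longer than every complete return to `U_{i_m}`
  set s := m + 1 + (R.i m + ∑ a, (p.label.word m a).length) with hs
  have hms : m < s := by omega
  have key : ∀ b, ∃ l c, p.label.image hms.le b = l ++ [c] ∧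
      R.U (R.i m) ++ p.label.word m c <:+ R.U (R.i s) := by
    intro b
    have hne := (R.toPartial s).image_ne_nil hms.le le_rfl b
    obtain ⟨l, c, hlc⟩ := (List.eq_nil_or_concat _).resolve_left hne
    rw [List.concat_eq_append] at hlc
    refine ⟨l, c, hlc, ?_⟩
    have h1 : R.U (R.i s) <:+ R.U (R.i s) ++ p.label.word s b := ((hC s).isReturn b).suffix
    have h2 : R.U (R.i m) ++ p.label.word m c <:+ R.U (R.i s) ++ p.label.word s b := by
      obtain ⟨t, ht⟩ := (R.toPartial s).U_suffix_of_le (R.i_strictMono.monotone hms.le)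
      obtain ⟨y, hy⟩ := (hC m).suffix_flatMap l
      refine ⟨t ++ y, ?_⟩
      rw [p.label.word_eq_flatMap hms.le, hlc, List.flatMap_append, List.flatMap_singleton]
      change t ++ R.U (R.i m) = R.U (R.i s) at ht
      change y ++ R.U (R.i m) = R.U (R.i m) ++ _ at hy
      rw [← ht]
      calc t ++ y ++ (R.U (R.i m) ++ p.label.word m c)
          = t ++ (y ++ R.U (R.i m)) ++ p.label.word m c := by simp
        _ = _ := by rw [hy]; simp
    refine List.suffix_of_suffix_length_le h2 h1 ?_
    have h3 : (p.label.word m c).length ≤ ∑ a, (p.label.word m a).length :=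
      Finset.single_le_sum (f := fun a => (p.label.word m a).length)
        (fun _ _ => Nat.zero_le _) (Finset.mem_univ c)
    have h4 := R.i_strictMono.le_apply (x := s)
    rw [List.length_append, R.U_length, R.U_length]
    omega
  have hcard : 2 ≤ p.label.card s := (R.toPartial s).two_le_card le_rfl
  obtain ⟨l₀, a, -, ha⟩ := key ⟨0, by omega⟩
  refine ⟨s, hms, a, fun b => ?_⟩
  obtain ⟨l, c, hlc, hc⟩ := key b
  rw [(hC m).eq_of_suffix ha hc]
  exact ⟨l, hlc⟩

lemma isRightProper_comp_iff {σ : MorphismSeq} {r s : ℕ} (h : r ≤ s) :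
    IsRightProper (σ.comp h) ↔ ∃ a, ∀ b, ∃ l, σ.image h b = l ++ [a] := by
  constructor
  · rintro ⟨a, ha⟩
    refine ⟨a, fun b => ?_⟩
    obtain ⟨u, hu⟩ := ha b
    exact ⟨FreeMonoid.toList u, by simp [MorphismSeq.image, hu, FreeMonoid.toList_mul]⟩
  · rintro ⟨a, ha⟩
    refine ⟨a, fun b => ?_⟩
    obtain ⟨l, hl⟩ := ha b
    refine ⟨FreeMonoid.ofList l, FreeMonoid.toList.injective ?_⟩
    simpa [MorphismSeq.image, FreeMonoid.toList_mul] using hl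

lemma Realization.exists_rightProper_contraction (R : Realization p X) :
    ∃ (i : ℕ → ℕ) (hi : StrictMono i), ∀ n, IsRightProper ((p.label.contraction i hi).mor n) := by
  -- iterate the step from `m` to an index from which the composition is right proper
  choose f hf a ha using R.exists_common_last
  have hi : StrictMono fun n => f^[n] 0 := by
    refine strictMono_nat_of_lt_succ fun n => ?_
    rw [Function.iterate_succ_apply']
    exact hf _
  refine ⟨_, hi, fun n => ?_⟩
  have key : ∀ t (ht : f^[n] 0 ≤ t), t = f (f^[n] 0) → IsRightProper (p.label.comp ht) := by
    rintro t ht rfl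
    exact (isRightProper_comp_iff ht).2 ⟨a _, ha _⟩
  exact key _ _ (Function.iterate_succ_apply' f n 0)

end Necessity

/-! ### Limits of subshifts -/

section Limits

open Filter Topology

variable {A : Type} [TopologicalSpace A]

/-- The subshift of the configurations all of whose factors are in `L`. -/
def ofLanguage [DiscreteTopology A] (L : Set (List A)) : Subshift A ℤ where
  carrier := {x | ∀ i n, window x i n ∈ L}
  isClosed := by
    have : {x : ℤ → A | ∀ i n, window x i n ∈ L} =
        ⋂ (w : List A) (_ : w ∉ L) (i : ℤ), {x | window x i w.length = w}ᶜ := by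
      ext x
      simp only [Set.mem_ofPred_eq, Set.mem_iInter, Set.mem_compl_iff]
      constructor
      · intro h w hw i hi
        exact hw (hi ▸ h i w.length)
      · intro h i n
        by_contra hn
        exact h _ hn i (by simp)
    rw [this]
    exact isClosed_iInter fun w => isClosed_iInter fun _ => isClosed_iInter fun i =>
      (isClopen_window_eq i w).compl.isClosed
  mapsTo := fun g x hx i n => by
    rw [window_shift]
    exact hx _ _

/-- If the languages of the subshifts `X n` converge to `L`, then `L` is a language: a word `w` of
`L` occurs at the origin in a configuration of `X n` for large `n`, and in any limit of these
configurations. -/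
lemma language_ofLanguage [DiscreteTopology A] [Finite A] {L : Set (List A)} {X : ℕ → Subshift A ℤ}
    (hX : ∀ m, ∀ᶠ n in atTop, AgreeUpTo m (language (X n)) L) :
    language (ofLanguage L) = L := by
  ext w
  constructor
  · intro hw
    obtain ⟨x, hx, i, hi⟩ := mem_language.1 hw
    exact hi ▸ hx i w.length
  · intro hw
    have hex : ∀ n, ∃ x : ℤ → A, w ∈ language (X n) → x ∈ (X n).carrier ∧
        window x 0 w.length = w := by
      intro n
      by_cases hn : w ∈ language (X n)
      · obtain ⟨x, hx, i, hi⟩ := mem_language.1 hn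
        exact ⟨shift i x, fun _ => ⟨(X n).mapsTo i hx, by rw [window_shift]; simpa using hi⟩⟩
      · have hne : Nonempty (ℤ → A) := by
          obtain ⟨n, hn⟩ := (hX w.length).exists
          obtain ⟨x, -⟩ := mem_language.1 ((hn w le_rfl).2 hw)
          exact ⟨x⟩
        exact ⟨hne.some, fun h => absurd h hn⟩
    choose x hx using hex
    -- a coordinatewise limit along an ultrafilter
    let F : Ultrafilter ℕ := Ultrafilter.of atTop
    have hF : (F : Filter ℕ) ≤ atTop := Ultrafilter.of_le _
    have hlim : ∀ j : ℤ, ∃ a : A, ∀ᶠ n in (F : Filter ℕ), x n j = a := by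
      intro j
      have : ∀ᶠ n in (F : Filter ℕ), ∃ a ∈ (Set.univ : Set A), x n j = a :=
        Eventually.of_forall fun n => ⟨x n j, trivial, rfl⟩
      obtain ⟨a, -, ha⟩ := (Ultrafilter.eventually_exists_mem_iff Set.finite_univ).1 this
      exact ⟨a, ha⟩
    choose y hy using hlim
    have hwin : ∀ i m, ∀ᶠ n in (F : Filter ℕ), window (x n) i m = window y i m := by
      intro i m
      have : ∀ᶠ n in (F : Filter ℕ), ∀ j : Fin m, x n (i + (j : ℕ)) = y (i + (j : ℕ)) :=
        eventually_all.2 fun j => hy _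
      filter_upwards [this] with n hn
      exact window_congr fun j hj => hn ⟨j, hj⟩
    have hmem : ∀ᶠ n in (F : Filter ℕ), w ∈ language (X n) := by
      filter_upwards [hF (hX w.length)] with n hn
      exact (hn w le_rfl).2 hw
    refine mem_language.2 ⟨y, fun i m => ?_, 0, ?_⟩
    · obtain ⟨n, h1, h2, h3⟩ := ((hwin i m).and (hmem.and (hF (hX m)))).exists
      rw [← h1]
      exact (h3 _ (by simp)).1 (window_mem_language (hx n h2).1 i m)
    · obtain ⟨n, h1, h2⟩ := ((hwin 0 w.length).and hmem).exists
      rw [← h1]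
      exact (hx n h2).2

/-- A subshift with a uniformly recurrent language is minimal. -/
lemma isMinimalSubshift_of_recurrent {X : Subshift A ℤ}
    (hX : ∀ u ∈ language X, ∃ K : ℕ, ∀ v ∈ language X, K ≤ v.length → u <:+: v) :
    IsMinimalSubshift X := by
  intro Y hYX
  rw [or_iff_not_imp_left]
  intro hne
  obtain ⟨x, hx⟩ := Set.nonempty_iff_ne_empty.2 hne
  refine hYX.antisymm fun y hy => ?_
  -- shifts of `x` that agree with `y` on larger and larger windows
  have hex : ∀ k : ℕ, ∃ z ∈ Y.carrier, window z (-k) (2 * k + 1) = window y (-k) (2 * k + 1) := by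
    intro k
    obtain ⟨K, hK⟩ := hX _ (window_mem_language hy (-k) (2 * k + 1))
    obtain ⟨s, t, hst⟩ := hK (window x 0 K) (window_mem_language (hYX hx) 0 K) (by simp)
    have h1 := window_eq_of_append hst.symm
    rw [length_window] at h1
    refine ⟨shift (s.length + k) x, Y.mapsTo _ hx, ?_⟩
    rw [window_shift, ← h1, zero_add, add_neg_cancel_right]
  choose z hz hzy using hex
  refine Y.isClosed.mem_of_tendsto (tendsto_pi_nhds.2 fun j => ?_)
    (Eventually.of_forall hz : ∀ᶠ k in atTop, z k ∈ Y.carrier)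
  refine tendsto_const_nhds.congr' ?_
  filter_upwards [eventually_ge_atTop j.natAbs] with k hk
  obtain ⟨a, ha⟩ : ∃ a : ℕ, (a : ℤ) = k + j := ⟨(k + j).toNat, by omega⟩
  have h1 := apply_eq_of_window_eq (hzy k) (a := a) (by omega)
  rw [show -(k : ℤ) + a = j by omega] at h1
  exact h1.symm

end Limits

/-! ### Stabilization of the realizations of longer and longer prefixes -/

section Stabilization

variable {p : LabelledPath}

lemma suffix_flatMap_of_ne_nil {A α : Type} {R : α → List A} {z : List A} {l : List α}
    (hl : l ≠ []) (hz : ∀ a ∈ l, z <:+ R a) : z <:+ l.flatMap R := by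
  obtain ⟨l', a, h⟩ := (List.eq_nil_or_concat l).resolve_left hl
  rw [List.concat_eq_append] at h
  subst h
  rw [List.flatMap_append, List.flatMap_singleton]
  exact (hz a (by simp)).trans (List.suffix_append _ _)

section Fixed

variable {N : ℕ} {X : Subshift (Fin (p.label.card 0)) ℤ}

lemma PartialRealization.U_ne_nil (r : PartialRealization p N rfl X) {t : ℕ} (ht : 0 < t) :
    r.U (r.i t) ≠ [] := by
  intro h
  have h1 := r.U_length (r.i t)
  have h2 := r.i_strictMono.le_apply (x := t)
  rw [h, List.length_nil] at h1
  omega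

/-- Every word of the subshift occurs in a concatenation of return words. -/
lemma PartialRealization.exists_infix_flatMap (r : PartialRealization p N rfl X) (hX : InClass X)
    {t : ℕ} (ht : 0 < t) (htN : t ≤ N) {v : List (Fin (p.label.card 0))} (hv : v ∈ language X) :
    ∃ l ≠ [], v <:+: l.flatMap (p.label.word t) := by
  have hL := hX.recurrentLanguage
  have hU := (r.U_rightSpecial (r.i t)).1
  obtain ⟨x, hx⟩ := hL.exists_left hU hv
  obtain ⟨y, hy⟩ := hL.exists_right hU hx
  obtain ⟨l, hl⟩ := (r.isReturnCoding htN).encode hL.factorial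
    (w := x ++ v ++ y ++ r.U (r.i t)) (by simpa using hy) ⟨r.U (r.i t) ++ x ++ v ++ y, by simp⟩
  refine ⟨l, ?_, ?_⟩
  · rintro rfl
    simp [r.U_ne_nil ht] at hl
  · rw [← hl]
    exact ⟨x, y ++ r.U (r.i t), by simp⟩

/-- Any word that starts with `U_{i_t}` is preceded in the language by a common suffix `z` of the
return words. -/
lemma PartialRealization.append_mem_language (r : PartialRealization p N rfl X) (hX : InClass X)
    {t : ℕ} (ht : 0 < t) (htN : t ≤ N) {z w : List (Fin (p.label.card 0))}
    (hz : ∀ b, z <:+ p.label.word t b) (hw : r.U (r.i t) ++ w ∈ language X) :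
    ∃ s, z <:+ s ∧ r.U (r.i t) <:+ s ∧ s ++ w ∈ language X := by
  have hL := hX.recurrentLanguage
  obtain ⟨x, hx⟩ := hL.exists_left (r.U_rightSpecial (r.i t)).1 hw
  have hmem : r.U (r.i t) ++ (x ++ r.U (r.i t)) ∈ language X :=
    hL.factorial ⟨[], w, by simp⟩ hx
  obtain ⟨l, hl⟩ := (r.isReturnCoding htN).encode hL.factorial hmem
    ⟨r.U (r.i t) ++ x, by simp⟩
  refine ⟨x ++ r.U (r.i t), ?_, List.suffix_append _ _, ?_⟩
  · rw [hl]
    refine suffix_flatMap_of_ne_nil ?_ fun b _ => hz b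
    rintro rfl
    simp [r.U_ne_nil ht] at hl
  · exact hL.factorial ⟨r.U (r.i t), [], by simp⟩ hx

/-- The short words of the language are determined by the labels of the first `t` steps. -/
lemma PartialRealization.mem_language_iff (r : PartialRealization p N rfl X) (hX : InClass X)
    {t : ℕ} (ht : 0 < t) (htN : t ≤ N) {z v : List (Fin (p.label.card 0))}
    (hz : ∀ b, z <:+ p.label.word t b) (hv : v.length ≤ z.length) :
    v ∈ language X ↔ ∃ b, v <:+: z ++ p.label.word t b := by
  constructor
  · intro h
    obtain ⟨l, hl, hvl⟩ := r.exists_infix_flatMap hX ht htN h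
    obtain ⟨b, -, hb⟩ := infix_of_infix_flatMap hl (fun a _ => hz a) hv hvl
    exact ⟨b, hb⟩
  · rintro ⟨b, hb⟩
    obtain ⟨s, ⟨s', hs⟩, -, hmem⟩ := r.append_mem_language hX ht htN hz
      ((r.isReturnCoding htN).isReturn b).mem
    refine language_factorial (hb.trans ?_) hmem
    exact ⟨s', [], by simp [← hs]⟩

lemma PartialRealization.U_suffix_of_common_suffix (r : PartialRealization p N rfl X)
    (hX : InClass X) {t : ℕ} (ht : 0 < t) (htN : t ≤ N) {z : List (Fin (p.label.card 0))}
    (hz : ∀ b, z <:+ p.label.word t b) {n : ℕ} (hn : n ≤ t) (hnz : n ≤ z.length) :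
    r.U n <:+ z := by
  obtain ⟨s, hzs, hUs, -⟩ := r.append_mem_language (w := []) hX ht htN hz
    (by simpa using (r.U_rightSpecial (r.i t)).1)
  have h1 := r.U_suffix_of_le (hn.trans (r.i_strictMono.le_apply (x := t)))
  exact List.suffix_of_suffix_length_le (h1.trans hUs) hzs (by rwa [r.U_length])

end Fixed

/-- Every finite prefix of `p` is realized by a subshift of the class, over the alphabet of `p`. -/
def AllPrefixesRealized (p : LabelledPath) : Prop :=
  ∀ N, ∃ X : Subshift (Fin (p.label.card 0)) ℤ, InClass X ∧ Nonempty (PartialRealization p N rfl X)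

lemma AllPrefixesRealized.two_le_card (hp : AllPrefixesRealized p) (n : ℕ) :
    2 ≤ p.label.card n := by
  obtain ⟨X, -, ⟨r⟩⟩ := hp n
  exact r.two_le_card le_rfl

lemma AllPrefixesRealized.image_ne_nil (hp : AllPrefixesRealized p) {s t : ℕ} (h : s ≤ t)
    (b : Fin (p.label.card t)) : p.label.image h b ≠ [] := by
  obtain ⟨X, -, ⟨r⟩⟩ := hp t
  exact r.image_ne_nil h le_rfl b

/-- Alphabets have at least two letters, so by weak primitivity the lengths tend to infinity. -/
lemma AllPrefixesRealized.exists_le_length_word (hp : AllPrefixesRealized p)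
    (hw : p.label.WeaklyPrimitive) (K : ℕ) :
    ∃ s, ∀ t, s ≤ t → ∀ b, K ≤ (p.label.word t b).length := by
  have hmono : ∀ K s, (∀ b, K ≤ (p.label.word s b).length) →
      ∀ t, s ≤ t → ∀ b, K ≤ (p.label.word t b).length := by
    intro K s hs t hst b
    obtain ⟨c, hc⟩ := List.exists_mem_of_ne_nil _ (hp.image_ne_nil hst b)
    rw [p.label.word_eq_flatMap hst]
    exact (hs c).trans (length_le_length_flatMap hc)
  suffices h : ∃ s, ∀ b, K ≤ (p.label.word s b).length by
    obtain ⟨s, hs⟩ := h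
    exact ⟨s, hmono K s hs⟩
  induction K with
  | zero => exact ⟨0, fun b => Nat.zero_le _⟩
  | succ K ih =>
    obtain ⟨s, hs⟩ := ih
    obtain ⟨t, hst, ht⟩ := hw s
    refine ⟨t + 1, fun b => ?_⟩
    have hcard := hp.two_le_card s
    have h0 : (⟨0, by omega⟩ : Fin (p.label.card s)) ∈ p.label.image (show s ≤ t + 1 by omega) b :=
      ht _ b
    have h1 : (⟨1, by omega⟩ : Fin (p.label.card s)) ∈ p.label.image (show s ≤ t + 1 by omega) b :=
      ht _ b
    rw [p.label.word_eq_flatMap (show s ≤ t + 1 by omega)]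
    obtain ⟨l₁, l₂, hl⟩ := List.append_of_mem h0
    rw [hl]
    have hword : ∀ c, 1 ≤ (p.label.word s c).length := fun c =>
      List.length_pos_iff.2 (hp.image_ne_nil s.zero_le c)
    have h01 : (⟨1, by omega⟩ : Fin (p.label.card s)) ∈ l₁ ++ l₂ := by
      rw [hl] at h1
      simpa using h1
    have h3 := (hword _).trans (length_le_length_flatMap (R := p.label.word s) h01)
    have h4 := hs ⟨0, by omega⟩
    simp only [List.flatMap_append, List.flatMap_cons, List.length_append] at h3 ⊢
    omega

/-- A right proper contraction provides long common suffixes of the words `σ_0 ⋯ σ_{t-1}(b)`. -/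
lemma AllPrefixesRealized.exists_common_suffix (hp : AllPrefixesRealized p)
    (hw : p.label.WeaklyPrimitive) {i : ℕ → ℕ} {hi : StrictMono i}
    (hrp : ∀ n, IsRightProper ((p.label.contraction i hi).mor n)) (m : ℕ) :
    ∃ t z, 0 < t ∧ m ≤ t ∧ m ≤ z.length ∧ ∀ b, z <:+ p.label.word t b := by
  obtain ⟨s, hs⟩ := hp.exists_le_length_word hw m
  obtain ⟨n, hn⟩ : ∃ n, n = max s m := ⟨_, rfl⟩
  obtain ⟨a, ha⟩ := (isRightProper_comp_iff (hi.monotone n.le_succ)).1 (hrp n)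
  have h1 := hi.le_apply (x := n)
  have h2 : i n < i (n + 1) := hi n.lt_succ_self
  refine ⟨i (n + 1), p.label.word (i n) a, by omega, by omega, hs _ (by omega) a, fun b => ?_⟩
  obtain ⟨l, hl⟩ := ha b
  rw [p.label.word_eq_flatMap (hi.monotone n.le_succ), hl, List.flatMap_append,
    List.flatMap_singleton]
  exact List.suffix_append _ _

end Stabilization

/-! ### The limit of the realizations of the prefixes -/

section Sufficiency

open Filter

/-- The `n`-th element of an infinite set depends on its elements up to this one only. -/
lemma eq_nth_of_range {P : ℕ → Prop} (hP : {k | P k}.Infinite) {f : ℕ → ℕ} (hf : StrictMono f)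
    {n : ℕ} (h : ∀ k ≤ Nat.nth P n, k ∈ Set.range f ↔ P k) : f n = Nat.nth P n := by
  classical
  set Q : ℕ → Prop := fun k => k ∈ Set.range f with hQ
  have hQinf : {k | Q k}.Infinite := Set.infinite_range_of_injective hf.injective
  have hfQ : f = Nat.nth Q := by
    refine (StrictMono.range_inj hf (Nat.nth_strictMono hQinf)).1 ?_
    rw [Nat.range_nth_of_infinite hQinf]
    rfl
  have hcount : Nat.count Q (Nat.nth P n) = n := by
    rw [Nat.count_eq_card_filter_range]
    conv_rhs => rw [← Nat.count_nth_of_infinite hP n, Nat.count_eq_card_filter_range]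
    congr 1
    apply Finset.filter_congr
    intro k hk
    exact h k (Finset.mem_range.1 hk).le
  have hmem : Q (Nat.nth P n) := (h _ le_rfl).2 (Nat.nth_mem_of_infinite hP n)
  rw [hfQ]
  conv_lhs => rw [← hcount]
  exact Nat.nth_count hmem

variable {p : LabelledPath}

/-- The labels decide membership of a word in the language of a realization of a long prefix; hence
these languages converge. -/
lemma eventually_agreeUpTo {X : ℕ → Subshift (Fin (p.label.card 0)) ℤ}
    (hX : ∀ N, InClass (X N)) (r : ∀ N, PartialRealization p N rfl (X N))
    (hsuf : ∀ m, ∃ t z, 0 < t ∧ m ≤ t ∧ m ≤ z.length ∧ ∀ b, z <:+ p.label.word t b) (m : ℕ) :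
    ∀ᶠ N in atTop, AgreeUpTo m (language (X N)) {w | ∀ᶠ M in atTop, w ∈ language (X M)} := by
  obtain ⟨t, z, ht, -, hmz, hz⟩ := hsuf m
  filter_upwards [eventually_ge_atTop t] with N hN w hw
  have hiff : ∀ M, t ≤ M → (w ∈ language (X M) ↔ ∃ b, w <:+: z ++ p.label.word t b) :=
    fun M hM => (r M).mem_language_iff (hX M) ht hM hz (hw.trans hmz)
  constructor
  · intro h
    filter_upwards [eventually_ge_atTop t] with M hM
    exact (hiff M hM).2 ((hiff N hN).1 h)
  · intro h
    obtain ⟨M, hM, hMt⟩ := (h.and (eventually_ge_atTop t)).exists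
    exact (hiff N hN).2 ((hiff M hMt).1 hM)

/-- By weak primitivity, every word of the limit language occurs in all the words
`σ_0 ⋯ σ_{t-1}(b)` for some `t`. -/
lemma exists_infix_word {X : ℕ → Subshift (Fin (p.label.card 0)) ℤ}
    (hX : ∀ N, InClass (X N)) (r : ∀ N, PartialRealization p N rfl (X N))
    (hsuf : ∀ m, ∃ t z, 0 < t ∧ m ≤ t ∧ m ≤ z.length ∧ ∀ b, z <:+ p.label.word t b)
    (hw : p.label.WeaklyPrimitive) {w : List (Fin (p.label.card 0))}
    (hwL : ∀ᶠ M in atTop, w ∈ language (X M)) :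
    ∃ t, 0 < t ∧ ∀ b, w <:+: p.label.word t b := by
  obtain ⟨t, z, ht, -, hmz, hz⟩ := hsuf w.length
  obtain ⟨M, hM, hMt⟩ := (hwL.and (eventually_ge_atTop t)).exists
  obtain ⟨b₀, hb₀⟩ := ((r M).mem_language_iff (hX M) ht hMt hz hmz).1 hM
  obtain ⟨s₁, hs₁, hprim₁⟩ := hw t
  obtain ⟨s₂, hs₂, hprim₂⟩ := hw (s₁ + 1)
  have h₁ : t ≤ s₁ + 1 := by omega
  have h₂ : s₁ + 1 ≤ s₂ + 1 := by omega
  refine ⟨s₂ + 1, by omega, fun b => ?_⟩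
  -- two distinct letters in the image of `b`: the second one yields an occurrence of `b₀` that is
  -- preceded by another letter
  have hcard := (r (s₁ + 1)).two_le_card le_rfl
  have hl : ∃ c l c' l', p.label.image h₂ b = c :: l ++ c' :: l' := by
    have h0 : (⟨0, by omega⟩ : Fin (p.label.card (s₁ + 1))) ∈ p.label.image h₂ b := hprim₂ _ b
    have h1 : (⟨1, by omega⟩ : Fin (p.label.card (s₁ + 1))) ∈ p.label.image h₂ b := hprim₂ _ b
    match hi : p.label.image h₂ b with
    | [] => simp [hi] at h0
    | [c] =>
      rw [hi, List.mem_singleton] at h0 h1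
      simp [← h0] at h1
    | c :: c' :: l' => exact ⟨c, [], c', l', rfl⟩
  obtain ⟨c, l, c', l', hl⟩ := hl
  obtain ⟨k, k', hk⟩ := List.append_of_mem (show b₀ ∈ p.label.image h₁ c' from hprim₁ b₀ c')
  obtain ⟨e, he⟩ : ∃ e, e = (c :: l).flatMap (p.label.image h₁) ++ k := ⟨_, rfl⟩
  have hne : e ≠ [] := by
    rw [he, List.flatMap_cons]
    simp [(r (s₁ + 1)).image_ne_nil h₁ le_rfl c]
  obtain ⟨y, hy⟩ := suffix_flatMap_of_ne_nil hne fun a _ => hz a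
  have himg : p.label.image (h₁.trans h₂) b =
      e ++ b₀ :: (k' ++ l'.flatMap (p.label.image h₁)) := by
    rw [p.label.image_trans h₁ h₂, hl, he]
    simp [hk]
  refine hb₀.trans ?_
  rw [p.label.word_eq_flatMap (h₁.trans h₂), himg, List.flatMap_append, List.flatMap_cons, ← hy]
  exact ⟨y, (k' ++ l'.flatMap (p.label.image h₁)).flatMap (p.label.word t), by simp⟩

/-- The limit of the realizations of longer and longer prefixes realizes the whole path. -/
lemma AllPrefixesRealized.isValid (hp : AllPrefixesRealized p) (hw : p.label.WeaklyPrimitive)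
    {i : ℕ → ℕ} {hi : StrictMono i}
    (hrp : ∀ n, IsRightProper ((p.label.contraction i hi).mor n)) : p.IsValid := by
  have hsuf := hp.exists_common_suffix hw hrp
  choose X hX hr using hp
  have r := fun N => (hr N).some
  have hagree := eventually_agreeUpTo hX r hsuf
  set L : Set (List (Fin (p.label.card 0))) := {w | ∀ᶠ M in atTop, w ∈ language (X M)} with hLdef
  have hlang : language (ofLanguage L) = L := language_ofLanguage hagree
  -- the limit subshift is minimal
  have hrec : ∀ u ∈ L, ∃ K : ℕ, ∀ v ∈ L, K ≤ v.length → u <:+: v := by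
    intro u hu
    obtain ⟨t, ht, hut⟩ := exists_infix_word hX r hsuf hw hu
    obtain ⟨K, hK⟩ : ∃ K, K = 1 + ∑ b, (p.label.word t b).length := ⟨_, rfl⟩
    have hlen : ∀ b, (p.label.word t b).length ≤ K := fun b => by
      have := Finset.single_le_sum (f := fun b => (p.label.word t b).length)
        (fun _ _ => Nat.zero_le _) (Finset.mem_univ b)
      omega
    refine ⟨2 * K, fun v hv hvK => ?_⟩
    obtain ⟨M, hM, hMt⟩ := ((show ∀ᶠ M in atTop, v ∈ language (X M) from hv).and
      (eventually_ge_atTop t)).exists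
    obtain ⟨l, -, hl⟩ := (r M).exists_infix_flatMap (hX M) ht hMt hM
    obtain ⟨b, -, hb⟩ := exists_infix_of_long (by omega) (fun b _ => hlen b) hvK hl
    exact (hut b).trans hb
  have hclass : InClass (ofLanguage L) := by
    refine ⟨isMinimalSubshift_of_recurrent (by rwa [hlang]), fun n => ?_⟩
    obtain ⟨M, hM⟩ := (hagree (n + 1)).exists
    rw [hlang, ← hM.complexity_eq le_rfl, ← hM.complexity_eq n.le_succ]
    exact (hX M).2 n
  have hL : RecurrentLanguage L := hlang ▸ hclass.recurrentLanguage
  -- the right special words stabilize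
  have hU : ∀ n, ∃ u, ∀ᶠ N in atTop, (r N).U n = u := by
    intro n
    obtain ⟨t, z, ht, hnt, hnz, hz⟩ := hsuf n
    refine ⟨z.drop (z.length - n), ?_⟩
    filter_upwards [eventually_ge_atTop t] with N hN
    have h1 := (r N).U_suffix_of_common_suffix (hX N) ht hN hz hnt hnz
    rw [List.suffix_iff_eq_drop.1 h1, (r N).U_length]
  choose U hU using hU
  have hUlen : ∀ n, (U n).length = n := fun n => by
    obtain ⟨N, hN⟩ := (hU n).exists
    rw [← hN, (r N).U_length]
  have hUrs : ∀ n, IsRightSpecial L (U n) := fun n => by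
    obtain ⟨N, hN, hN'⟩ := ((hU n).and (hagree (n + 1))).exists
    rw [← hN, ← hN'.isRightSpecial (by rw [(r N).U_length])]
    exact (r N).U_rightSpecial n
  -- the lengths of the bispecial words stabilize
  set P : ℕ → Prop := fun k => ∃ u, u.length = k ∧ IsBispecial L u with hP
  have hPinf : {k | P k}.Infinite := by
    refine Set.infinite_of_forall_exists_gt fun n => ?_
    obtain ⟨v, hv, huv⟩ := hL.exists_bispecial (hUrs (n + 1))
    have := huv.length_le
    rw [hUlen] at this
    exact ⟨v.length, ⟨v, rfl, hv⟩, by omega⟩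
  have hI : ∀ n, ∀ᶠ N in atTop, (r N).i n = Nat.nth P n := by
    intro n
    filter_upwards [hagree (Nat.nth P n + 1)] with N hN
    refine eq_nth_of_range hPinf (r N).i_strictMono fun k hk => ?_
    rw [(r N).i_range]
    refine exists_congr fun u => and_congr_right fun hu => ?_
    exact hN.isBispecial (by omega)
  have hstable : ∀ n, ∀ᶠ N in atTop, n ≤ N ∧ (r N).i n = Nat.nth P n ∧
      (r N).U (Nat.nth P n) = U (Nat.nth P n) ∧
      (r N).θ n = fun a => pathOf (U (Nat.nth P n)) (p.label.word n a) := by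
    intro n
    filter_upwards [eventually_ge_atTop n, hI n, hU (Nat.nth P n)] with N h1 h2 h3
    refine ⟨h1, h2, h3, ?_⟩
    ext1 a
    rw [(r N).θ_eq_pathOf h1, h2, h3]
  refine ⟨ofLanguage L, hclass, ⟨?_⟩⟩
  exact
    { i := Nat.nth P
      i_strictMono := Nat.nth_strictMono hPinf
      i_range := by
        intro k
        rw [Nat.range_nth_of_infinite hPinf, hlang]
        rfl
      U := U
      U_length := hUlen
      U_rightSpecial := by rwa [hlang]
      U_suffix := by
        intro n
        obtain ⟨N, h1, h2⟩ := ((hU n).and (hU (n + 1))).exists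
        rw [← h1, ← h2]
        exact (r N).U_suffix n
      θ := fun n a => pathOf (U (Nat.nth P n)) (p.label.word n a)
      θ_injective := by
        intro n
        obtain ⟨N, h1, h2, h3, h4⟩ := (hstable n).exists
        rw [← h4]
        exact (r N).θ_injective n h1
      θ_range := by
        intro n q
        -- the first bound serves the edges of the Rauzy graph, the second one the full label of `q`
        obtain ⟨N, ⟨h1, h2, h3, h4⟩, h5⟩ := ((hstable n).and (hagree (Nat.nth P n + 1 +
          (Nat.nth P n + (rightLabel q).length)))).exists
        rw [← h4, (r N).θ_range n h1, h2, h3, hlang]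
        have hmem := h5 (U (Nat.nth P n) ++ rightLabel q) (by
          rw [List.length_append, hUlen]; omega)
        have h6 := h5.mono (show Nat.nth P n + 1 ≤ _ from Nat.le_add_right _ _)
        have h7 := h6.isRightSpecial (u := U (Nat.nth P n)) (by rw [hUlen])
        constructor
        · rintro ⟨g1, g2, g3, g4, g5⟩
          exact ⟨h7.1 g1, g2.of_agreeUpTo h6, g3, g4, hmem.1 g5⟩
        · rintro ⟨g1, g2, g3, g4, g5⟩
          exact ⟨h7.2 g1, g2.of_agreeUpTo h6.symm, g3, g4, hmem.2 g5⟩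
      θ_procedure := by
        intro n
        obtain ⟨N, ⟨h1, h2, h3, h4⟩, h5⟩ := ((hstable n).and (hagree (Nat.nth P n + 1))).exists
        rw [← h4, hlang]
        have := (r N).θ_procedure n h1
        rw [h2, h3] at this
        exact this.of_agreeUpTo h5
      θ_zero := by
        intro a
        simp [MorphismSeq.word_zero]
      label_eq := by
        intro n a
        obtain ⟨N, ⟨h1, h2, h3, h4⟩, h5, h6, h7, h8⟩ := ((hstable n).and (hstable (n + 1))).exists
        have := (r N).label_eq n h5 a
        rw [h4, h8, h2, h6] at this
        exact this }

end Sufficiency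

end RauzyPath

theorem mainTheorem6 (p : RauzyPath.LabelledPath) (hp : p.IsInGraphOfGraphs) :
    p.IsValid ↔
      (∀ n, p.IsValidPrefix n) ∧
        (p.label.WeaklyPrimitive ∧
          ∃ (i : ℕ → ℕ) (hi : StrictMono i),
            ∀ n, RauzyPath.IsRightProper ((p.label.contraction i hi).mor n)) := by
  constructor
  · intro h
    obtain ⟨X, hX, ⟨R⟩⟩ := id h
    exact ⟨fun n => ⟨p, h, fun _ _ => rfl⟩, R.weaklyPrimitive hX, R.exists_rightProper_contraction⟩
  · rintro ⟨hpre, hw, i, hi, hrp⟩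
    have hall : RauzyPath.AllPrefixesRealized p := fun N => (hpre (N + 1)).exists_partialRealization
    exact hall.isValid hw hrp
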